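/- Let $m\ge 1$ and $n\ge 0$ be integers. For $i\in[m]=\{1,\dots,m\}$ let $f_i:\mathbb{R}^n\to\mathbb{R}$, $A_i\in\mathbb{R}^{m_i\times n}$, $b_i\in\mathbb{R}^{m_i}$, and let $\mathcal{J}\subseteq[n]$. Put $f=\sum_{i=1}^m f_i$ and consider the linearly constrained problem $$\min_{x\in\mathbb{R}^n} f(x)\quad\text{s.t.}\quad A_ix=b_i\ (i\in[m]),\qquad x_j\ge 0\ (j\in\mathcal{J}),\tag{1}$$ whose feasible set is assumed to be nonempty. Put $$g_i(x)=\tfrac12\|A_ix-b_i\|_2^2+\tfrac1{2m}\sum_{j\in\mathcal{J}}\max\{0,-x_j\}^2,\qquad g=\sum_{i=1}^m g_i ,$$ and consider the bilevel problem $$\min_{x\in\mathbb{R}^n} f(x)\quad\text{s.t.}\quad x\in\operatorname{argmin}_{z\in\mathbb{R}^n} g(z).\tag{2}$$ Assumptions. (A1) There are $\mu_f,L_f>0$ such that every $f_i$ is continuously differentiable with $(\nabla f_i(x)-\nabla f_i(y))^T(x-y)\ge\mu_f\|x-y\|_2^2$ and $\|\nabla f_i(x)-\nabla f_i(y)\|_2\le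 L_f\|x-y\|_2$ for all $x,y$. (A2) $\mathbf{R},\mathbf{C}\in\mathbb{R}^{m\times m}$ are nonnegative with strictly positive diagonals, $\mathbf{R}\mathbf{1}=\mathbf{1}$ and $\mathbf{1}^T\mathbf{C}=\mathbf{1}^T$. For a nonnegative matrix $\mathbf{B}\in\mathbb{R}^{m\times m}$ let $\mathcal{G}_{\mathbf{B}}$ be the digraph on $[m]$ with an edge from $j$ to $i$ if and only if $B_{ij}>0$. Some vertex is both the root of a directed spanning tree of $\mathcal{G}_{\mathbf{R}}$ and the root of a directed spanning tree of $\mathcal{G}_{\mathbf{C}^T}$. Let $u,\nu\in\mathbb{R}^m$ be the nonnegative vectors with $u^T\mathbf{R}=u^T$, $u^T\mathbf{1}=m$, $\mathbf{C}\nu=\nu$, $\mathbf{1}^T\nu=m$. (A3) Let $0<\epsilon<3/5$, $a=0.2$, $b=0.2-\epsilon/3$, $\hat\gamma_0,\lambda_0>0$ and $\lambda_k=\lambda_0/(k+1)^b$. The step-sizes $\gamma_{i,k}\ge0$ satisfy $\max_{i\in[m]}\gamma_{i,k}=\hat\gamma_k:=\hat\gamma_0/(k+1)^a$ for all $k\ge0$,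 and there is $\theta>0$ with $\tfrac1m\sum_{i=1}^m u_i\gamma_{i,k}\nu_i\ge\theta\hat\gamma_k$ for all $k\ge 0$. Algorithm. Start from arbitrary $x_{i,0}\in\mathbb{R}^n$ and $y_{i,0}=\nabla g_i(x_{i,0})+\lambda_0\nabla f_i(x_{i,0})$, and for $k\ge0$ and $i\in[m]$ let $$x_{i,k+1}=\sum_{j=1}^m R_{ij}(x_{j,k}-\gamma_{j,k}y_{j,k}),$$ $$y_{i,k+1}=\sum_{j=1}^m C_{ij}y_{j,k}+\nabla g_i(x_{i,k+1})+\lambda_{k+1}\nabla f_i(x_{i,k+1})-\nabla g_i(x_{i,k})-\lambda_k\nabla f_i(x_{i,k}).$$ Let $\mathbf{x}_k,\mathbf{y}_k\in\mathbb{R}^{m\times n}$ be the matrices with rows $x_{i,k}^T$ and $y_{i,k}^T$, and let $\bar x_k=\tfrac1m\sum_{i}u_ix_{i,k}$ and $\bar y_k=\tfrac1m\sum_i y_{i,k}$, which are read as row vectors in $\mathbf{1}\bar x_k$ and $\nu\bar y_k$. Let $\|\cdot\|_{\mathbf{R}}$ and $\|\cdot\|_{\mathbf{C}}$ be any two norms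 on $\mathbb{R}^m$, extended to matrices $W\in\mathbb{R}^{m\times n}$ with columns $W_{\bullet 1},\dots,W_{\bullet n}$ by $\|W\|=\big\|\big[\|W_{\bullet1}\|,\dots,\|W_{\bullet n}\|\big]\big\|_2$. Conclusion. The set $\operatorname{argmin} g$ equals the feasible set of (1), so that (1) and (2) have the same optimal solutions, and there is $L_g>0$ such that every $g_i$ is convex and continuously differentiable with an $L_g$-Lipschitz gradient. Problem (1) has a unique optimal solution $x^*$, and $\lim_{k\to\infty}\bar x_k=x^*$. Moreover, as $k\to\infty$: (a) $\|\mathbf{x}_{k+1}-\mathbf{1}\bar x_{k+1}\|_{\mathbf{R}}=\mathcal{O}(1/k^{0.6+\epsilon/3})$ and $\|\mathbf{y}_{k+1}-\nu\bar y_{k+1}\|_{\mathbf{C}}=\mathcal{O}(1/k^{0.6+\epsilon/3})$; (b) there is a constant $Q>0$ with $f(\bar x_k)-f(x^*)\le Q/k^{1-\epsilon}$ for all sufficiently large $k$; (c) $\|\mathbf{A}\bar x_k-\mathbf{b}\|_2^2=\mathcal{O}(1/k^{0.2-\epsilon/3})$, where $\mathbf{A}$ and $\mathbf{b}$ are obtained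 by stacking $A_1,\dots,A_m$ and $b_1,\dots,b_m$. -/

import Mathlib

open Filter Topology

noncomputable section

/-! ### Functions -/

/-- `f` is continuously differentiable with a `μ`-strongly monotone gradient. -/
def IsStronglyConvexC1 {n : ℕ} (μ : ℝ) (f : EuclideanSpace ℝ (Fin n) → ℝ) : Prop :=
  ContDiff ℝ 1 f ∧ ∀ x y : EuclideanSpace ℝ (Fin n),
    μ * ‖x - y‖ ^ 2 ≤ inner ℝ (gradient f x - gradient f y) (x - y)

/-- `f` is continuously differentiable with an `L`-Lipschitz gradient, where `L > 0`. -/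
def IsLSmooth {n : ℕ} (L : ℝ) (f : EuclideanSpace ℝ (Fin n) → ℝ) : Prop :=
  0 < L ∧ ContDiff ℝ 1 f ∧ ∀ x y : EuclideanSpace ℝ (Fin n),
    ‖gradient f x - gradient f y‖ ≤ L * ‖x - y‖

/-- The set of global minimizers of `h`. -/
def argminSet {E : Type*} (h : E → ℝ) : Set E := {x | ∀ y, h x ≤ h y}

/-- `x` is an optimal solution of the problem of minimizing `h` over `S`. -/
def IsOptimalOn {E : Type*} (h : E → ℝ) (S : Set E) (x : E) : Prop :=
  x ∈ S ∧ ∀ y ∈ S, h x ≤ h y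

/-- The sum of the local functions of the agents. -/
def totalFun {m n : ℕ} (f : Fin m → EuclideanSpace ℝ (Fin n) → ℝ) :
    EuclideanSpace ℝ (Fin n) → ℝ := fun x => ∑ i, f i x

/-! ### The linearly constrained problem -/

/-- The points with `A i x = b i` for every agent `i` and `x j ≥ 0` for `j ∈ J`. -/
def linFeasible {m n : ℕ} {p : Fin m → ℕ} (A : ∀ i, Matrix (Fin (p i)) (Fin n) ℝ)
    (b : ∀ i, EuclideanSpace ℝ (Fin (p i))) (J : Finset (Fin n)) :
    Set (EuclideanSpace ℝ (Fin n)) :=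
  {x | (∀ i, Matrix.toEuclideanLin (A i) x = b i) ∧ ∀ j ∈ J, 0 ≤ x j}

/-- The local infeasibility measure
`g i x = ‖A i x - b i‖² / 2 + (1 / (2 m)) ∑_{j ∈ J} max {0, - x j}²`. -/
def penalty {m n : ℕ} {p : Fin m → ℕ} (A : ∀ i, Matrix (Fin (p i)) (Fin n) ℝ)
    (b : ∀ i, EuclideanSpace ℝ (Fin (p i))) (J : Finset (Fin n)) (i : Fin m) :
    EuclideanSpace ℝ (Fin n) → ℝ := fun x =>
  1 / 2 * ‖Matrix.toEuclideanLin (A i) x - b i‖ ^ 2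
    + 1 / (2 * (m : ℝ)) * ∑ j ∈ J, (max 0 (-(x j))) ^ 2

/-- The matrix obtained by stacking the matrices `A i` on top of each other. -/
def stackMatrix {m n : ℕ} {p : Fin m → ℕ} (A : ∀ i, Matrix (Fin (p i)) (Fin n) ℝ) :
    Matrix (Σ i : Fin m, Fin (p i)) (Fin n) ℝ :=
  Matrix.of fun q j => A q.1 q.2 j

/-- The vector obtained by stacking the vectors `b i` on top of each other. -/
def stackVector {m : ℕ} {p : Fin m → ℕ} (b : ∀ i, EuclideanSpace ℝ (Fin (p i))) :
    EuclideanSpace ℝ (Σ i : Fin m, Fin (p i)) :=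
  WithLp.toLp 2 fun q => b q.1 q.2

/-! ### Induced digraphs and mixing matrices -/

/-- Edges of the digraph induced by a matrix `B`: there is an edge from the parent `j` to the
child `i` if and only if `B i j > 0`. -/
def inducedEdge {m : ℕ} (B : Matrix (Fin m) (Fin m) ℝ) (j i : Fin m) : Prop := 0 < B i j

/-- `T` is the edge relation of a (directed) spanning tree with root `r` of the digraph `G`:
its edges are edges of `G`, the root has no parent, every other vertex has exactly one parent,
and every vertex can be reached from the root along edges of the tree. -/
structure IsSpanningTree {m : ℕ} (G T : Fin m → Fin m → Prop) (r : Fin m) : Prop where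
  sub : ∀ j i, T j i → G j i
  root_no_parent : ∀ j, ¬ T j r
  unique_parent : ∀ i, i ≠ r → ∃! j, T j i
  reach : ∀ i, Relation.ReflTransGen T r i

/-- The roots of all spanning trees of the digraph induced by `B`. -/
def treeRoots {m : ℕ} (B : Matrix (Fin m) (Fin m) ℝ) : Set (Fin m) :=
  {r | ∃ T : Fin m → Fin m → Prop, IsSpanningTree (inducedEdge B) T r}

/-- The assumptions on the pulling matrix `R` and the pushing matrix `C`. -/
structure MixingMatrices {m : ℕ} (R C : Matrix (Fin m) (Fin m) ℝ) : Prop where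
  R_nonneg : ∀ i j, 0 ≤ R i j
  R_diag : ∀ i, 0 < R i i
  R_row : ∀ i, ∑ j, R i j = 1
  C_nonneg : ∀ i j, 0 ≤ C i j
  C_diag : ∀ i, 0 < C i i
  C_col : ∀ j, ∑ i, C i j = 1
  common_root : (treeRoots R ∩ treeRoots C.transpose).Nonempty

/-- `u` is the nonnegative left eigenvector of `R` for the eigenvalue `1` whose entries add up
to `m`. -/
structure IsLeftWeight {m : ℕ} (R : Matrix (Fin m) (Fin m) ℝ) (u : Fin m → ℝ) : Prop where
  nonneg : ∀ i, 0 ≤ u i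
  eigen : Matrix.vecMul u R = u
  sum_eq : ∑ i, u i = (m : ℝ)

/-- `v` is the nonnegative right eigenvector of `C` for the eigenvalue `1` whose entries add up
to `m`. -/
structure IsRightWeight {m : ℕ} (C : Matrix (Fin m) (Fin m) ℝ) (v : Fin m → ℝ) : Prop where
  nonneg : ∀ i, 0 ≤ v i
  eigen : Matrix.mulVec C v = v
  sum_eq : ∑ i, v i = (m : ℝ)

/-! ### The algorithm -/

/-- The regularization parameter `lam0 / (k + 1) ^ b`. -/
def regParam (lam0 b : ℝ) (k : ℕ) : ℝ := lam0 / ((k : ℝ) + 1) ^ b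

/-- The update rules: the largest step-size at iteration `k` is `gam0 / (k + 1) ^ a`, the
regularization parameter is `regParam lam0 b k`, and the weighted step-size
`(1 / m) uᵀ diag (γ k) v` is at least `θ` times the largest one for some `θ > 0`. -/
structure UpdateRules {m : ℕ} (u v : Fin m → ℝ) (γ : ℕ → Fin m → ℝ)
    (gam0 lam0 a b : ℝ) : Prop where
  b_pos : 0 < b
  b_lt_a : b < a
  a_lt_one : a < 1
  add_lt_one : a + b < 1
  gam0_pos : 0 < gam0
  lam0_pos : 0 < lam0
  step_nonneg : ∀ k j, 0 ≤ γ k j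
  step_max : ∀ k : ℕ, IsGreatest (Set.range (γ k)) (gam0 / ((k : ℝ) + 1) ^ a)
  weighted : ∃ θ : ℝ, 0 < θ ∧ ∀ k : ℕ,
    θ * (gam0 / ((k : ℝ) + 1) ^ a) ≤ 1 / (m : ℝ) * ∑ j, u j * γ k j * v j

/-- The iterates `(x_k, y_k)` of the iteratively regularized push-pull method, where `x_k i`
and `y_k i` are the vectors held by agent `i`. -/
def pushPull {m n : ℕ} (f g : Fin m → EuclideanSpace ℝ (Fin n) → ℝ)
    (R C : Matrix (Fin m) (Fin m) ℝ) (γ : ℕ → Fin m → ℝ) (lam : ℕ → ℝ)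
    (x0 : Fin m → EuclideanSpace ℝ (Fin n)) :
    ℕ → (Fin m → EuclideanSpace ℝ (Fin n)) × (Fin m → EuclideanSpace ℝ (Fin n))
  | 0 => (x0, fun i => gradient (g i) (x0 i) + lam 0 • gradient (f i) (x0 i))
  | k + 1 =>
    let x := (pushPull f g R C γ lam x0 k).1
    let y := (pushPull f g R C γ lam x0 k).2
    let x' : Fin m → EuclideanSpace ℝ (Fin n) := fun i => ∑ j, R i j • (x j - γ k j • y j)
    (x', fun i => (∑ j, C i j • y j)
      + gradient (g i) (x' i) + lam (k + 1) • gradient (f i) (x' i)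
      - gradient (g i) (x i) - lam k • gradient (f i) (x i))

/-- The weighted average `(1 / m) ∑ i, w i • x i` of the local copies. -/
def weightedMean {m n : ℕ} (w : Fin m → ℝ) (x : Fin m → EuclideanSpace ℝ (Fin n)) :
    EuclideanSpace ℝ (Fin n) := (1 / (m : ℝ)) • ∑ i, w i • x i

/-- The matrix norm induced by a vector norm `N` on `ℝ^m`: the Euclidean norm of the vector of
the `N`-norms of the columns of the `m × n` matrix whose rows are the vectors `w i`. -/
def inducedNorm {m n : ℕ} (N : Seminorm ℝ (Fin m → ℝ))
    (w : Fin m → EuclideanSpace ℝ (Fin n)) : ℝ :=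
  Real.sqrt (∑ j : Fin n, (N fun i => w i j) ^ 2)

end

/-! ### Rates of scalar recursions -/

/-! The comparison object is the Tikhonov path: `z k` minimizes `g + λ_k f`. As `g` is nonnegative
and vanishes exactly on the feasible set, `f (z k) ≤ f x*` and `g (z k) → 0`, so compactness and
uniqueness give `z k → x*`. Subtracting the optimality conditions at consecutive parameters and
using strong monotonicity, the drift of the path is at most a constant times `|λ_k - λ_{k+1}| / λ_k
= O(1/k)` (`norm_sub_le_of_regularized`).

Three errors are followed: `d`, the distance from the weighted average to `z k`; `p`, the consensus
error; `q`, the tracking error. Column stochasticity of `C` keeps the sum of the trackers equal to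
the sum of the current regularized gradients, so the average makes an inexact gradient step, which
contracts `d` by `1 - c γ_k λ_k` (`norm_mean_step_le`). The spanning trees make powers of `R` and
`C` minus their rank-one limits small (`exists_pow_sub_rankOne_le`), hence `p` and `q` contract by a
fixed factor in adapted norms (`exists_contracting_norm`). The couplings carry a factor `γ_k`,
except that of `p` into `q`; the perturbations are `O(1/k)`.

Because `γ_k / λ_k → 0`, a weighted sum of the errors obeys one scalar recursion with contraction
`γ_k λ_k` and forcing `1/k`. Its balance is `(1/k) / (γ_k λ_k)`, of order `k^-(1-a-b)`, which is
`k^-(3/5+ε/3)` here (`coupled_rate_three`, `pushPull_rates`). The bounds on `f` and on infeasibility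
follow from quadratic growth of `g + λ_k f` around `z k`, by comparing its minimum with the value
`λ_k f x*` at `x*`. -/

lemma one_div_rpow_sub_succ_le {r : ℝ} (h1 : r ≤ 1) (k : ℕ) :
    1 / ((k : ℝ) + 1) ^ r - 1 / ((k + 1 : ℕ) + 1 : ℝ) ^ r
      ≤ 1 / ((k : ℝ) + 1) * (1 / ((k : ℝ) + 1) ^ r) := by
  have hk : (0 : ℝ) < (k : ℝ) + 1 := by positivity
  have hk2 : (0 : ℝ) < (k : ℝ) + 2 := by positivity
  have hcast : (((k + 1 : ℕ) : ℝ) + 1) = (k : ℝ) + 2 := by push_cast; ring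
  rw [hcast]
  -- For a base at most `1`, lowering the exponent from `1` to `r` can only increase the power.
  have hq : ((k : ℝ) + 1) / (k + 2) ≤ (((k : ℝ) + 1) / (k + 2)) ^ r := by
    have := Real.rpow_le_rpow_of_exponent_ge (x := ((k : ℝ) + 1) / (k + 2)) (by positivity)
      (by rw [div_le_one hk2]; linarith) h1
    simpa using this
  rw [Real.div_rpow hk.le hk2.le] at hq
  have hA : 0 < ((k : ℝ) + 1) ^ r := Real.rpow_pos_of_pos hk r
  have hB : 0 < ((k : ℝ) + 2) ^ r := Real.rpow_pos_of_pos hk2 r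
  have h3 : 1 - 1 / ((k : ℝ) + 1) ≤ ((k : ℝ) + 1) / (k + 2) := by
    rw [sub_le_iff_le_add, div_add_div _ _ hk2.ne' hk.ne', le_div_iff₀ (by positivity)]
    nlinarith
  have h4 : (1 - 1 / ((k : ℝ) + 1)) * (1 / ((k : ℝ) + 1) ^ r) ≤ 1 / ((k : ℝ) + 2) ^ r := by
    calc _ ≤ ((k : ℝ) + 1) ^ r / (k + 2) ^ r * (1 / ((k : ℝ) + 1) ^ r) := by
          gcongr
          exact h3.trans hq
      _ = _ := by field_simp
  linarith

lemma one_div_rpow_succ_le {r : ℝ} (h0 : 0 ≤ r) (k : ℕ) :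
    1 / ((k + 1 : ℕ) + 1 : ℝ) ^ r ≤ 1 / ((k : ℝ) + 1) ^ r := by
  apply one_div_le_one_div_of_le (by positivity)
  apply Real.rpow_le_rpow (by positivity) _ h0
  push_cast; linarith

lemma tendsto_const_div_rpow_zero {r : ℝ} (h0 : 0 < r) (c : ℝ) :
    Tendsto (fun k : ℕ => c / ((k : ℝ) + 1) ^ r) atTop (𝓝 0) := by
  have h : Tendsto (fun k : ℕ => ((k : ℝ) + 1) ^ r) atTop atTop :=
    (tendsto_rpow_atTop h0).comp
      (tendsto_atTop_add_const_right _ _ tendsto_natCast_atTop_atTop)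
  exact h.const_div_atTop c

lemma eventually_const_div_rpow_le {r : ℝ} (h0 : 0 < r) (c : ℝ) {η : ℝ} (hη : 0 < η) :
    ∀ᶠ k : ℕ in atTop, c / ((k : ℝ) + 1) ^ r ≤ η :=
  (tendsto_const_div_rpow_zero h0 c).eventually_le_const hη

/-- Half of the contraction `c δ` absorbs the forcing, and the other half pays for the decrease of
`w`. So `w` bounds `V` as soon as its relative decrease is at most `c δ / 2`. -/
lemma eventually_le_mul_of_recursion {V δ w : ℕ → ℝ} {c c' : ℝ} (hc : 0 < c)
    (hδ : ∀ k, 0 ≤ δ k) (hw0 : ∀ k, 0 < w k)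
    (hV : ∀ᶠ k in atTop, V (k + 1) ≤ (1 - c * δ k) * V k + c' * (δ k * w k))
    (hcδ : ∀ᶠ k in atTop, c * δ k ≤ 1)
    (hw : ∀ᶠ k in atTop, w k - w (k + 1) ≤ c / 2 * (δ k * w k)) :
    ∃ M : ℝ, 0 ≤ M ∧ ∀ᶠ k in atTop, V k ≤ M * w k := by
  obtain ⟨K, hK⟩ := eventually_atTop.1 (hV.and (hcδ.and hw))
  -- `2 c' / c` makes the forcing at most half of the contraction; `V K / w K` starts the induction.
  set M : ℝ := max 0 (max (2 * c' / c) (V K / w K))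
  have hM0 : 0 ≤ M := le_max_left _ _
  have hM1 : 2 * c' / c ≤ M := (le_max_left _ _).trans (le_max_right _ _)
  have hM2 : V K / w K ≤ M := (le_max_right _ _).trans (le_max_right _ _)
  refine ⟨M, hM0, eventually_atTop.2 ⟨K, fun k hk => ?_⟩⟩
  induction k, hk using Nat.le_induction with
  | base => exact (div_le_iff₀ (hw0 K)).1 hM2
  | succ k hk ih =>
    obtain ⟨h1, h2, h3⟩ := hK k hk
    have h4 : (1 - c * δ k) * V k ≤ (1 - c * δ k) * (M * w k) :=
      mul_le_mul_of_nonneg_left ih (by linarith)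
    have h5 : c' ≤ c / 2 * M := by
      rw [div_le_iff₀ hc] at hM1; linarith
    have h6 : c' * (δ k * w k) ≤ c / 2 * M * (δ k * w k) :=
      mul_le_mul_of_nonneg_right h5 (mul_nonneg (hδ k) (hw0 k).le)
    have h7 := mul_le_mul_of_nonneg_left h3 hM0
    nlinarith

/-- Two coupled recursions: a slowly contracting one of rate `1 - c₀ γ λ` and a geometrically
contracting one, coupled through the step-size `γ`, under perturbations of order `1 / k`. -/
lemma coupled_rate_two {d e : ℕ → ℝ} {a b g0 l0 c0 c τ : ℝ} (hb : 0 < b) (hba : b < a)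
    (hab : a + b < 1) (hg0 : 0 < g0) (hl0 : 0 < l0) (hc0 : 0 < c0) (hc : 0 < c) (hτ : τ < 1)
    (hτ0 : 0 ≤ τ) (hd0 : ∀ k, 0 ≤ d k) (he0 : ∀ k, 0 ≤ e k)
    (hd : ∀ᶠ k : ℕ in atTop, d (k + 1) ≤
      (1 - c0 * (g0 / ((k : ℝ) + 1) ^ a * (l0 / ((k : ℝ) + 1) ^ b))) * d k
        + c * (g0 / ((k : ℝ) + 1) ^ a) * e k + c * (1 / ((k : ℝ) + 1)))
    (he : ∀ᶠ k : ℕ in atTop, e (k + 1) ≤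
      τ * e k + c * (g0 / ((k : ℝ) + 1) ^ a) * d k + c * (1 / ((k : ℝ) + 1))) :
    ∃ M : ℝ, 0 ≤ M ∧ ∀ᶠ k : ℕ in atTop,
      d k ≤ M * (1 / ((k : ℝ) + 1) ^ (1 - a - b)) ∧
      e k ≤ M * (1 / ((k : ℝ) + 1) ^ (1 - a - b)) := by
  have ha : 0 < a := hb.trans hba
  set G : ℕ → ℝ := fun k => g0 / ((k : ℝ) + 1) ^ a with hG
  set Λ : ℕ → ℝ := fun k => l0 / ((k : ℝ) + 1) ^ b with hΛ
  set w : ℕ → ℝ := fun k => 1 / ((k : ℝ) + 1) ^ (1 - a - b) with hw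
  have hG0 : ∀ k, 0 < G k := fun k => by positivity
  have hΛ0 : ∀ k, 0 < Λ k := fun k => by positivity
  have hw0 : ∀ k, 0 < w k := fun k => by positivity
  have hGle : ∀ k, G (k + 1) ≤ G k := fun k => by
    have := mul_le_mul_of_nonneg_left (one_div_rpow_succ_le ha.le k) hg0.le
    simpa [hG, div_eq_mul_inv] using this
  have hGg : ∀ k, G k ≤ g0 := fun k => by
    apply div_le_self hg0.le
    exact Real.one_le_rpow (by linarith [Nat.cast_nonneg (α := ℝ) k]) ha.le
  -- The exponent of `w` is dictated here: a `1/k` perturbation is exactly the contraction `G Λ`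
  -- times `w`.
  have hprod : ∀ k : ℕ, G k * Λ k * w k = g0 * l0 * (1 / ((k : ℝ) + 1)) := fun k => by
    have hk : (0 : ℝ) < (k : ℝ) + 1 := by positivity
    have : ((k : ℝ) + 1) ^ a * ((k : ℝ) + 1) ^ b * ((k : ℝ) + 1) ^ (1 - a - b) = (k : ℝ) + 1 := by
      rw [← Real.rpow_add hk, ← Real.rpow_add hk]
      norm_num
    simp only [hG, hΛ, hw]
    rw [div_mul_div_comm, div_mul_div_comm, this]
    ring
  have hratio : ∀ k : ℕ, G k = g0 / l0 / ((k : ℝ) + 1) ^ (a - b) * Λ k := fun k => by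
    have hk : (0 : ℝ) < (k : ℝ) + 1 := by positivity
    simp only [hG, hΛ]
    rw [Real.rpow_sub hk]
    field_simp
  have hwle : ∀ k : ℕ, w k - w (k + 1) ≤ 1 / ((k : ℝ) + 1) * w k := fun k =>
    one_div_rpow_sub_succ_le (by linarith) k
  have hwk : ∀ k : ℕ, 1 / ((k : ℝ) + 1) ≤ w k := fun k => by
    apply one_div_le_one_div_of_le (by positivity)
    calc ((k : ℝ) + 1) ^ (1 - a - b) ≤ ((k : ℝ) + 1) ^ (1 : ℝ) :=
          Real.rpow_le_rpow_of_exponent_le (by linarith [Nat.cast_nonneg (α := ℝ) k])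
            (by linarith)
      _ = _ := Real.rpow_one _
  set S : ℝ := 2 * c / (1 - τ) with hS
  have hτ' : 0 < 1 - τ := by linarith
  have hS0 : 0 < S := by positivity
  have hSτ : c + S * τ = S * ((1 + τ) / 2) := by
    rw [hS]; field_simp; ring
  -- Weighting `e` by `G` matches its influence `c G e` on `d`. The value of `S` gives `c + S τ = S
  -- (1 + τ) / 2`, so the `e` part still contracts geometrically after paying for this coupling.
  set V : ℕ → ℝ := fun k => d k + S * G k * e k with hVdef
  -- The feedback of `d` through `e` is of order `G²`. Since `b < a`, it is eventually at most half
  -- of the contraction `c0 G Λ`.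
  have hsmall1 : ∀ᶠ k : ℕ in atTop, S * c * G k ≤ c0 / 2 * Λ k := by
    filter_upwards [eventually_const_div_rpow_le (sub_pos.2 hba) (g0 / l0)
      (show 0 < c0 / 2 / (S * c) by positivity)] with k hk
    rw [hratio k]
    have := mul_le_mul_of_nonneg_right hk (hΛ0 k).le
    calc _ ≤ S * c * (c0 / 2 / (S * c) * Λ k) := by gcongr
      _ = _ := by field_simp
  have hsmall2 : ∀ η : ℝ, 0 < η → ∀ᶠ k : ℕ in atTop, G k * Λ k ≤ η := fun η hη => by
    have h1 := (tendsto_const_div_rpow_zero ha g0).mul (tendsto_const_div_rpow_zero hb l0)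
    rw [mul_zero] at h1
    exact h1.eventually_le_const hη
  have hVrec : ∀ᶠ k : ℕ in atTop, V (k + 1) ≤ (1 - c0 / 2 * (G k * Λ k)) * V k
      + (c + S * g0 * c) / (g0 * l0) * (G k * Λ k * w k) := by
    filter_upwards [hd, he, hsmall1, hsmall2 ((1 - τ) / c0) (by positivity)] with k h1 h2 h3 h4
    rw [hprod k]
    have e1 : (c + S * g0 * c) / (g0 * l0) * (g0 * l0 * (1 / ((k : ℝ) + 1)))
        = (c + S * g0 * c) * (1 / ((k : ℝ) + 1)) := by field_simp
    rw [e1]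
    have hk1 : 0 ≤ 1 / ((k : ℝ) + 1) := by positivity
    have h5 : S * G (k + 1) * e (k + 1) ≤ S * G k * (τ * e k + c * G k * d k)
        + S * g0 * (c * (1 / ((k : ℝ) + 1))) := by
      calc S * G (k + 1) * e (k + 1) ≤ S * G k * e (k + 1) := by
            gcongr
            · exact he0 _
            · exact hGle k
        _ ≤ S * G k * (τ * e k + c * G k * d k + c * (1 / ((k : ℝ) + 1))) := by
            have := (hG0 k).le
            gcongr
        _ = S * G k * (τ * e k + c * G k * d k) + S * G k * (c * (1 / ((k : ℝ) + 1))) := by ring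
        _ ≤ _ := by
            gcongr
            exact hGg k
    have h6 : S * c * G k * (G k * d k) ≤ c0 / 2 * Λ k * (G k * d k) :=
      mul_le_mul_of_nonneg_right h3 (mul_nonneg (hG0 k).le (hd0 k))
    have h7 : (1 + τ) / 2 ≤ 1 - c0 / 2 * (G k * Λ k) := by
      rw [le_div_iff₀ hc0] at h4
      linarith
    have h8 : (c + S * τ) * (G k * e k) ≤ S * (1 - c0 / 2 * (G k * Λ k)) * (G k * e k) := by
      rw [hSτ]
      have := (hG0 k).le
      have := he0 k
      gcongr
    simp only [hVdef]
    nlinarith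
  obtain ⟨M, hM, hMV⟩ := eventually_le_mul_of_recursion (δ := fun k => G k * Λ k) (w := w)
    (half_pos hc0) (fun k => (mul_pos (hG0 k) (hΛ0 k)).le) hw0 hVrec
    (by
      filter_upwards [hsmall2 (1 / (c0 / 2)) (by positivity)] with k hk
      rwa [le_div_iff₀' (by positivity)] at hk)
    (by
      have := eventually_const_div_rpow_le (show 0 < 1 - a - b by linarith) 1
        (show 0 < c0 / 2 / 2 * (g0 * l0) by positivity)
      filter_upwards [this] with k hk
      refine (hwle k).trans ?_
      rw [hprod]
      have hk1 : 0 ≤ 1 / ((k : ℝ) + 1) := by positivity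
      calc _ ≤ 1 / ((k : ℝ) + 1) * (c0 / 2 / 2 * (g0 * l0)) := by gcongr
        _ = _ := by ring)
  have hdM : ∀ᶠ k in atTop, d k ≤ M * w k := by
    filter_upwards [hMV] with k hk
    have : 0 ≤ S * G k * e k := mul_nonneg (mul_pos hS0 (hG0 k)).le (he0 k)
    simp only [hVdef] at hk
    linarith
  -- The bound on `V` controls only `G e`. Feeding the rate of `d` back into the recursion of `e`,
  -- whose contraction is constant, recovers the full rate for `e`.
  obtain ⟨M', hM', hMe⟩ := eventually_le_mul_of_recursion (V := e) (δ := fun _ => 1) (w := w)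
    (c' := c * g0 * M + c) hτ' (fun k => zero_le_one) hw0
    (by
      filter_upwards [he, hdM] with k h1 h2
      have h3 : c * G k * d k ≤ c * g0 * (M * w k) := by
        have := hd0 k
        gcongr
        exact hGg k
      have h4 : c * (1 / ((k : ℝ) + 1)) ≤ c * w k := by
        gcongr
        exact hwk k
      nlinarith)
    (by filter_upwards with k; linarith)
    (by
      have := eventually_const_div_rpow_le one_pos 1 (half_pos hτ')
      filter_upwards [this] with k hk
      rw [Real.rpow_one] at hk
      refine (hwle k).trans ?_
      rw [one_mul]
      exact mul_le_mul_of_nonneg_right hk (hw0 k).le)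
  refine ⟨max M M', hM.trans (le_max_left _ _), ?_⟩
  filter_upwards [hdM, hMe] with k h1 h2
  exact ⟨h1.trans (mul_le_mul_of_nonneg_right (le_max_left _ _) (hw0 k).le),
    h2.trans (mul_le_mul_of_nonneg_right (le_max_right _ _) (hw0 k).le)⟩

/-- Rates of the optimality error `d`, the consensus error `p` and the tracking error `q`. -/
lemma coupled_rate_three {d p q : ℕ → ℝ} {a b g0 l0 c0 c σ : ℝ} (hb : 0 < b) (hba : b < a)
    (hab : a + b < 1) (hg0 : 0 < g0) (hl0 : 0 < l0) (hc0 : 0 < c0) (hc : 0 < c) (hσ : σ < 1)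
    (hσ0 : 0 ≤ σ) (hd0 : ∀ k, 0 ≤ d k) (hp0 : ∀ k, 0 ≤ p k) (hq0 : ∀ k, 0 ≤ q k)
    (hd : ∀ᶠ k : ℕ in atTop, d (k + 1) ≤
      (1 - c0 * (g0 / ((k : ℝ) + 1) ^ a * (l0 / ((k : ℝ) + 1) ^ b))) * d k
        + c * (g0 / ((k : ℝ) + 1) ^ a) * (p k + q k) + c * (1 / ((k : ℝ) + 1)))
    (hp : ∀ᶠ k : ℕ in atTop, p (k + 1) ≤
      σ * p k + c * (g0 / ((k : ℝ) + 1) ^ a) * (p k + q k + d k))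
    (hq : ∀ᶠ k : ℕ in atTop, q (k + 1) ≤
      σ * q k + c * p k + c * (g0 / ((k : ℝ) + 1) ^ a) * (p k + q k + d k)
        + c * (1 / ((k : ℝ) + 1))) :
    ∃ M : ℝ, 0 ≤ M ∧ ∀ᶠ k : ℕ in atTop,
      d k ≤ M * (1 / ((k : ℝ) + 1) ^ (1 - a - b)) ∧
      p k ≤ M * (1 / ((k : ℝ) + 1) ^ (1 - a - b)) ∧
      q k ≤ M * (1 / ((k : ℝ) + 1) ^ (1 - a - b)) := by
  have ha : 0 < a := hb.trans hba
  have hσ' : 0 < 1 - σ := by linarith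
  -- In `p + η q` the coupling `c p` inside `q` costs `(1 - σ) / 4`, and small step-sizes cost
  -- another `(1 - σ) / 4`. This leaves the contraction factor `(1 + σ) / 2`.
  set η : ℝ := (1 - σ) / 4 / c with hη
  have hη0 : 0 < η := by positivity
  have hηc : η * c = (1 - σ) / 4 := by rw [hη]; field_simp
  have hpq : ∀ k, p k + q k ≤ (1 + 1 / η) * (p k + η * q k) := fun k => by
    have h1 : (1 + 1 / η) * (p k + η * q k) = p k + q k + (η * q k + 1 / η * p k) := by
      field_simp; ring
    have := mul_nonneg hη0.le (hq0 k)
    have := mul_nonneg (one_div_pos.2 hη0).le (hp0 k)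
    linarith
  have hc1 : c ≤ c * (1 + η) * (1 + 1 / η) := by
    have : 1 ≤ (1 + η) * (1 + 1 / η) := by
      have := one_div_pos.2 hη0
      nlinarith
    nlinarith
  have hc2 : c * (1 + η) ≤ c * (1 + η) * (1 + 1 / η) := by
    have := one_div_pos.2 hη0
    have : 0 < c * (1 + η) := by positivity
    nlinarith
  have hc3 : c * (1 + 1 / η) ≤ c * (1 + η) * (1 + 1 / η) := by
    have : 0 < c * (1 + 1 / η) := by positivity
    nlinarith
  obtain ⟨M, hM, h⟩ := coupled_rate_two (d := d) (e := fun k => p k + η * q k)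
    (c := c * (1 + η) * (1 + 1 / η)) (τ := (1 + σ) / 2) hb hba hab hg0 hl0 hc0
    (by positivity) (by linarith) (by linarith) hd0
    (fun k => add_nonneg (hp0 k) (mul_nonneg hη0.le (hq0 k)))
    (by
      filter_upwards [hd] with k h1
      have hG : 0 < g0 / ((k : ℝ) + 1) ^ a := by positivity
      have hk1 : 0 ≤ 1 / ((k : ℝ) + 1) := by positivity
      have h2 : c * (g0 / ((k : ℝ) + 1) ^ a) * (p k + q k)
          ≤ c * (1 + η) * (1 + 1 / η) * (g0 / ((k : ℝ) + 1) ^ a) * (p k + η * q k) := by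
        calc _ ≤ c * (g0 / ((k : ℝ) + 1) ^ a) * ((1 + 1 / η) * (p k + η * q k)) := by
              gcongr
              exact hpq k
          _ = c * (1 + 1 / η) * ((g0 / ((k : ℝ) + 1) ^ a) * (p k + η * q k)) := by ring
          _ ≤ c * (1 + η) * (1 + 1 / η) * ((g0 / ((k : ℝ) + 1) ^ a) * (p k + η * q k)) := by
              have := mul_nonneg hη0.le (hq0 k)
              have := hp0 k
              gcongr
          _ = _ := by ring
      have h3 := mul_le_mul_of_nonneg_right hc1 hk1
      linarith)
    (by
      filter_upwards [hp, hq, eventually_const_div_rpow_le ha g0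
        (show 0 < (1 - σ) / 4 / (c * (1 + η) * (1 + 1 / η)) by positivity)] with k h1 h2 h3
      have hG : 0 < g0 / ((k : ℝ) + 1) ^ a := by positivity
      have hk1 : 0 ≤ 1 / ((k : ℝ) + 1) := by positivity
      set G := g0 / ((k : ℝ) + 1) ^ a
      have hp := hp0 k
      have hq := hq0 k
      have hd := hd0 k
      have hηq := mul_nonneg hη0.le hq
      have h4 : η * q (k + 1) ≤ η * (σ * q k + c * p k + c * G * (p k + q k + d k)
        + c * (1 / ((k : ℝ) + 1))) := mul_le_mul_of_nonneg_left h2 hη0.le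
      have h5 : c * (1 + η) * G * (p k + q k) ≤ (1 - σ) / 4 * (p k + η * q k) := by
        rw [le_div_iff₀ (by positivity)] at h3
        calc _ ≤ c * (1 + η) * G * ((1 + 1 / η) * (p k + η * q k)) := by
              gcongr
              exact hpq k
          _ = G * (c * (1 + η) * (1 + 1 / η)) * (p k + η * q k) := by ring
          _ ≤ _ := by gcongr
      have h6 : c * (1 + η) * (G * d k) ≤ c * (1 + η) * (1 + 1 / η) * (G * d k) :=
        mul_le_mul_of_nonneg_right hc2 (by positivity)
      have h7 : η * c * (1 / ((k : ℝ) + 1))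
          ≤ c * (1 + η) * (1 + 1 / η) * (1 / ((k : ℝ) + 1)) := by
        refine mul_le_mul_of_nonneg_right (le_trans ?_ hc2) hk1
        nlinarith
      have h8 : η * c * p k = (1 - σ) / 4 * p k := by rw [hηc]
      have h9 : 0 ≤ (1 - σ) / 4 * p k := by positivity
      have h10 : 0 ≤ (1 - σ) / 4 * (η * q k) := by positivity
      nlinarith)
  refine ⟨M * (1 + 1 / η), by positivity, ?_⟩
  filter_upwards [h] with k hk
  have hk0 : 0 ≤ 1 / ((k : ℝ) + 1) ^ (1 - a - b) := by positivity
  have h1 : p k + q k ≤ M * (1 + 1 / η) * (1 / ((k : ℝ) + 1) ^ (1 - a - b)) := by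
    calc _ ≤ (1 + 1 / η) * (p k + η * q k) := hpq k
      _ ≤ (1 + 1 / η) * (M * (1 / ((k : ℝ) + 1) ^ (1 - a - b))) := by gcongr; exact hk.2
      _ = _ := by ring
  refine ⟨hk.1.trans (mul_le_mul_of_nonneg_right ?_ hk0), ?_, ?_⟩
  · have := one_div_pos.2 hη0
    nlinarith
  · linarith [hq0 k]
  · linarith [hp0 k]

/-! ### Powers of mixing matrices -/

/-- The absolute row sums of `A` are at most `c`. -/
def RowSumLe {m : ℕ} (A : Matrix (Fin m) (Fin m) ℝ) (c : ℝ) : Prop := ∀ i, ∑ j, |A i j| ≤ c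

lemma RowSumLe.mul {m : ℕ} {A B : Matrix (Fin m) (Fin m) ℝ} {a b : ℝ} (hA : RowSumLe A a)
    (hB : RowSumLe B b) (hb : 0 ≤ b) : RowSumLe (A * B) (a * b) := fun i => by
  calc ∑ j, |(A * B) i j| ≤ ∑ j, ∑ l, |A i l| * |B l j| := by
        refine Finset.sum_le_sum fun j _ => ?_
        rw [Matrix.mul_apply]
        exact (Finset.abs_sum_le_sum_abs _ _).trans_eq (by simp [abs_mul])
    _ = ∑ l, |A i l| * ∑ j, |B l j| := by
        rw [Finset.sum_comm]; simp [Finset.mul_sum]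
    _ ≤ ∑ l, |A i l| * b := by gcongr with l; exact hB l
    _ = (∑ l, |A i l|) * b := by rw [Finset.sum_mul]
    _ ≤ a * b := by gcongr; exact hA i

lemma RowSumLe.pow {m : ℕ} {A : Matrix (Fin m) (Fin m) ℝ} {a : ℝ} (hA : RowSumLe A a)
    (ha : 0 ≤ a) (k : ℕ) : RowSumLe (A ^ k) (a ^ k) := by
  induction k with
  | zero => intro i; simp [Matrix.one_apply, apply_ite abs]
  | succ k ih => rw [pow_succ, pow_succ]; exact ih.mul hA ha

lemma exists_rowSumLe {m : ℕ} (A : Matrix (Fin m) (Fin m) ℝ) :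
    ∃ c, 0 ≤ c ∧ RowSumLe A c :=
  ⟨∑ i, ∑ j, |A i j|, by positivity, fun i =>
    Finset.single_le_sum (f := fun i => ∑ j, |A i j|) (fun _ _ => by positivity)
      (Finset.mem_univ i)⟩

/-- If `r` is the root of a spanning tree of the digraph of `R`, the column `r` of large powers
of `R` is positive. -/
lemma eventually_pow_apply_root_pos {m : ℕ} {R : Matrix (Fin m) (Fin m) ℝ}
    (hR : ∀ i j, 0 ≤ R i j) (hd : ∀ i, 0 < R i i) {r : Fin m} (hr : r ∈ treeRoots R) :
    ∀ᶠ k : ℕ in atTop, ∀ i, 0 < (R ^ k) i r := by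
  obtain ⟨T, hT⟩ := hr
  have hstep : ∀ k i j, 0 < R i j → 0 < (R ^ k) j r → 0 < (R ^ (k + 1)) i r :=
    fun k i j h1 h2 => by
      rw [pow_succ', Matrix.mul_apply]
      exact Finset.sum_pos' (fun l _ => mul_nonneg (hR i l) (Matrix.pow_apply_nonneg hR k l r))
        ⟨j, Finset.mem_univ j, mul_pos h1 h2⟩
  rw [eventually_all]
  intro i
  -- Each tree edge raises the needed exponent by one; the diagonal entry at the root keeps the base
  -- case positive for every exponent.
  induction hT.reach i with
  | refl =>
    refine Eventually.of_forall fun k => ?_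
    induction k with
    | zero => simp
    | succ k ih => exact hstep k r r (hd r) ih
  | tail _ h ih =>
    obtain ⟨K, hK⟩ := eventually_atTop.1 ih
    refine eventually_atTop.2 ⟨K + 1, fun k hk => ?_⟩
    obtain ⟨k, rfl⟩ : ∃ l, k = l + 1 := ⟨k - 1, by omega⟩
    exact hstep k _ _ (hT.sub _ _ h) (hK k (by omega))

/-- The powers of a row-stochastic matrix whose digraph has a spanning tree tend to the rank one
projection `𝟏 πᵀ` along its stationary vector `π`. -/
lemma exists_pow_sub_rankOne_le {m : ℕ} {R : Matrix (Fin m) (Fin m) ℝ}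
    (hR : ∀ i j, 0 ≤ R i j) (hd : ∀ i, 0 < R i i) (hrow : ∀ i, ∑ j, R i j = 1)
    (hr : (treeRoots R).Nonempty) {w : Fin m → ℝ} (hw : Matrix.vecMul w R = w)
    (hw1 : ∑ i, w i = 1) {η : ℝ} (hη : 0 < η) :
    ∃ N : ℕ, 1 ≤ N ∧ ∀ i j, |((R - Matrix.vecMulVec 1 w : Matrix (Fin m) (Fin m) ℝ) ^ N) i j| ≤ η := by
  obtain ⟨r, hr⟩ := hr
  obtain ⟨N, hN, hN1⟩ := ((eventually_pow_apply_root_pos hR hd hr).and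
    (eventually_ge_atTop 1)).exists
  have hmne : (Finset.univ : Finset (Fin m)).Nonempty := ⟨r, Finset.mem_univ r⟩
  obtain ⟨i0, -, hi0⟩ := Finset.exists_min_image Finset.univ (fun i => (R ^ N) i r) hmne
  set δ := (R ^ N) i0 r with hδ
  have hδ0 : 0 < δ := hN i0
  set J : Matrix (Fin m) (Fin m) ℝ := Matrix.vecMulVec 1 w with hJ
  have hR1 : Matrix.mulVec R 1 = 1 := by
    ext i; simp [Matrix.mulVec, dotProduct, hrow]
  have hRJ : R * J = J := by rw [hJ, Matrix.mul_vecMulVec, hR1]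
  have hJR : J * R = J := by rw [hJ, Matrix.vecMulVec_mul, hw]
  have hJ1 : Matrix.mulVec J 1 = 1 := by
    ext i; simp [hJ, Matrix.mulVec, dotProduct, Matrix.vecMulVec, hw1]
  have hJJ : J * J = J := by
    conv_lhs => rw [hJ, Matrix.mul_vecMulVec, ← hJ, hJ1]
  have hJRk : ∀ k, J * R ^ k = J := fun k => by
    induction k with
    | zero => simp
    | succ k ih => rw [pow_succ, ← mul_assoc, ih, hJR]
  -- `J` is a projection absorbing `R` on both sides, so all cross terms collapse.
  have hpow : ∀ k, 1 ≤ k → (R - J) ^ k = R ^ k - J := fun k hk => by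
    induction k, hk using Nat.le_induction with
    | base => simp
    | succ k _ ih =>
      rw [pow_succ', ih, sub_mul, mul_sub, mul_sub, hRJ, hJRk, hJJ, sub_self, sub_zero, ← pow_succ']
  have hRk1 : ∀ k, Matrix.mulVec (R ^ k) 1 = 1 := fun k => by
    induction k with
    | zero => simp
    | succ k ih => rw [pow_succ, ← Matrix.mulVec_mulVec, hR1, ih]
  set Q := R ^ N with hQ
  -- Doeblin's minorization: column `r` of `Q` is at least `δ`, so removing `δ` from it leaves a
  -- nonnegative matrix with row sums `1 - δ`. The removed part is of the form `𝟏 sᵀ`, which `Q - J`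
  -- annihilates, so in powers of `Q - J` every factor but the first may be replaced by `Q'`.
  set Q' : Matrix (Fin m) (Fin m) ℝ := Q - Matrix.vecMulVec 1 (Pi.single r δ) with hQ'
  have hkill : ∀ s : Fin m → ℝ, (Q - J) * Matrix.vecMulVec 1 s = 0 := fun s => by
    rw [Matrix.mul_vecMulVec, Matrix.sub_mulVec, hRk1, hJ1, sub_self]
    ext; simp [Matrix.vecMulVec]
  have hQJ : (Q - J) * (Q - J) = (Q - J) * Q' := by
    have h1 := hkill w
    have h2 := hkill (Pi.single r δ)
    rw [hQ', mul_sub (Q - J) Q J, mul_sub (Q - J) Q _, h2, hJ, h1]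
  have hpowQ : ∀ k, (Q - J) ^ (k + 1) = (Q - J) * Q' ^ k := fun k => by
    induction k with
    | zero => simp
    | succ k ih =>
      rw [pow_succ', ih, ← mul_assoc, hQJ, mul_assoc, ← pow_succ']
  have hQ'0 : ∀ i j, 0 ≤ Q' i j := fun i j => by
    simp only [hQ', Matrix.sub_apply, Matrix.vecMulVec_apply, Pi.one_apply, one_mul]
    by_cases hj : j = r
    · subst hj
      simpa using hi0 i (Finset.mem_univ i)
    · simpa [hj] using Matrix.pow_apply_nonneg hR N i j
  have hQ'row : ∀ i, ∑ j, Q' i j = 1 - δ := fun i => by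
    have h1 : ∑ j, Q i j = 1 := by
      have := congrFun (hRk1 N) i
      simpa [Matrix.mulVec, dotProduct] using this
    simp [hQ', h1]
  have hδ1 : 0 ≤ 1 - δ := by
    rw [← hQ'row r]; exact Finset.sum_nonneg fun j _ => hQ'0 r j
  have hQ'b : RowSumLe Q' (1 - δ) := fun i => by
    rw [← hQ'row i]
    exact (Finset.sum_congr rfl fun j _ => abs_of_nonneg (hQ'0 i j)).le
  obtain ⟨c, hc0, hc⟩ := exists_rowSumLe (Q - J)
  have hlim : Tendsto (fun k : ℕ => c * (1 - δ) ^ k) atTop (𝓝 0) := by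
    have := (tendsto_pow_atTop_nhds_zero_of_lt_one hδ1 (by linarith)).const_mul c
    simpa using this
  obtain ⟨k, hk⟩ := (hlim.eventually_le_const hη).exists
  refine ⟨N * (k + 1), by nlinarith, fun i j => ?_⟩
  rw [pow_mul, hpow N hN1, hpowQ k]
  calc _ ≤ ∑ l, |((Q - J) * Q' ^ k) i l| :=
        Finset.single_le_sum (f := fun l => |((Q - J) * Q' ^ k) i l|)
          (fun _ _ => abs_nonneg _) (Finset.mem_univ j)
    _ ≤ c * (1 - δ) ^ k := hc.mul (hQ'b.pow hδ1 k) (by positivity) i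
    _ ≤ η := hk

/-! ### Matrices acting on families of vectors, and adapted norms -/

section Action

open scoped Matrix.Module

variable {m : ℕ} {E : Type*} [NormedAddCommGroup E] [NormedSpace ℝ E]

lemma RowSumLe.norm_smul_le {A : Matrix (Fin m) (Fin m) ℝ} {c : ℝ} (hA : RowSumLe A c)
    (hc : 0 ≤ c) (w : Fin m → E) : ‖A • w‖ ≤ c * ‖w‖ := by
  rw [pi_norm_le_iff_of_nonneg (by positivity)]
  intro i
  rw [Matrix.Module.smul_apply]
  calc _ ≤ ∑ j, |A i j| * ‖w‖ := by
        refine (norm_sum_le _ _).trans (Finset.sum_le_sum fun j _ => ?_)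
        rw [norm_smul, Real.norm_eq_abs]
        gcongr
        exact norm_le_pi_norm w j
    _ = (∑ j, |A i j|) * ‖w‖ := by rw [Finset.sum_mul]
    _ ≤ c * ‖w‖ := by gcongr; exact hA i

/-- If a power of `M` has small entries, then `M` contracts some norm. -/
lemma exists_contracting_norm {M : Matrix (Fin m) (Fin m) ℝ}
    (hM : ∀ η > 0, ∃ N : ℕ, 1 ≤ N ∧ ∀ i j, |(M ^ N) i j| ≤ η) :
    ∃ (σ c : ℝ) (P : (Fin m → E) → ℝ), 0 ≤ σ ∧ σ < 1 ∧ 0 ≤ c ∧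
      (∀ w, ‖w‖ ≤ P w) ∧ (∀ w, P w ≤ c * ‖w‖) ∧ (∀ w w', P (w + w') ≤ P w + P w') ∧
      ∀ w, P (M • w) ≤ σ * P w := by
  -- Entries this small make the row sums of `M ^ N` at most `1/2`; `m + 1` also covers `m = 0`.
  obtain ⟨N, hN1, hN⟩ := hM (1 / 2 / (m + 1)) (by positivity)
  have hrow : RowSumLe (M ^ N) (1 / 2) := fun i => by
    calc ∑ j, |(M ^ N) i j| ≤ ∑ _j : Fin m, (1 / 2 / (m + 1) : ℝ) :=
          Finset.sum_le_sum fun j _ => hN i j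
      _ = (m : ℝ) / (m + 1) * (1 / 2) := by simp; ring
      _ ≤ 1 * (1 / 2) := by
          gcongr
          rw [div_le_one (by positivity)]; linarith
      _ = 1 / 2 := one_mul _
  set ρ : ℝ := (1 / 2 : ℝ) ^ (1 / (N : ℝ)) with hρ
  have hN0 : (0 : ℝ) < N := by exact_mod_cast hN1
  have hρ0 : 0 < ρ := by positivity
  have hρ1 : ρ < 1 := Real.rpow_lt_one (by norm_num) (by norm_num) (by positivity)
  have hρN : ρ ^ N = 1 / 2 := by
    rw [hρ, ← Real.rpow_natCast, ← Real.rpow_mul (by norm_num), one_div_mul_cancel hN0.ne',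
      Real.rpow_one]
  choose b hb0 hb using fun i : ℕ => exists_rowSumLe (M ^ i)
  -- The adapted norm is `∑_{i<N} ρ^(-i) ‖M^i w‖` with `ρ^N = 1/2`. Applying `M` shifts the sum by
  -- one index, up to the factor `ρ`, and the new last term is `2 ‖M^N w‖ ≤ ‖w‖`, the term that was
  -- lost.
  refine ⟨ρ, ∑ i ∈ Finset.range N, (ρ ^ i)⁻¹ * b i,
    fun w => ∑ i ∈ Finset.range N, (ρ ^ i)⁻¹ * ‖M ^ i • w‖, hρ0.le, hρ1,
    Finset.sum_nonneg fun i _ => mul_nonneg (by positivity) (hb0 i), fun w => ?_, fun w => ?_,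
    fun w w' => ?_, fun w => ?_⟩
  · have := Finset.single_le_sum (f := fun i => (ρ ^ i)⁻¹ * ‖M ^ i • w‖)
      (fun _ _ => by positivity) (Finset.mem_range.2 hN1)
    simpa using this
  · rw [Finset.sum_mul]
    refine Finset.sum_le_sum fun i _ => ?_
    rw [mul_assoc]
    gcongr
    exact (hb i).norm_smul_le (hb0 i) w
  · rw [← Finset.sum_add_distrib]
    refine Finset.sum_le_sum fun i _ => ?_
    rw [← mul_add, smul_add]
    gcongr
    exact norm_add_le _ _
  · set F : ℕ → ℝ := fun i => (ρ ^ i)⁻¹ * ‖M ^ i • w‖ with hF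
    have h1 : ∀ i, (ρ ^ i)⁻¹ * ‖M ^ i • M • w‖ = ρ * F (i + 1) := fun i => by
      rw [hF, smul_smul, ← pow_succ]
      field_simp
      ring
    have h2 : F N ≤ F 0 := by
      have h3 := hrow.norm_smul_le (by norm_num) w
      simp only [hF, hρN, pow_zero, inv_one, one_mul, one_smul]
      linarith
    have h4 := Finset.sum_range_succ F N
    rw [Finset.sum_range_succ'] at h4
    simp only [h1]
    rw [← Finset.mul_sum]
    refine mul_le_mul_of_nonneg_left ?_ hρ0.le
    linarith

end Action

/-! ### Gradients of convex functions -/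

section Convex

variable {E : Type*} [NormedAddCommGroup E] [InnerProductSpace ℝ E] [CompleteSpace E]
  {f : E → ℝ} {G : E → E}

lemma HasGradientAt.hasDerivAt_comp_line (hG : ∀ x, HasGradientAt f (G x) x) (x v : E) (t : ℝ) :
    HasDerivAt (fun s : ℝ => f (x + s • v)) (inner ℝ (G (x + t • v)) v) t := by
  have h1 : HasDerivAt (fun s : ℝ => x + s • v) v t := by
    simpa using ((hasDerivAt_id t).smul_const v).const_add x
  have h2 := (hG (x + t • v)).hasFDerivAt.comp_hasDerivAt t h1
  simpa [Function.comp_def] using h2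

lemma HasGradientAt.exists_sub_eq_inner (hG : ∀ x, HasGradientAt f (G x) x) (x y : E) :
    ∃ t ∈ Set.Ioo (0 : ℝ) 1, f y - f x = inner ℝ (G (x + t • (y - x))) (y - x) := by
  obtain ⟨t, ht, h⟩ := exists_hasDerivAt_eq_slope (fun s : ℝ => f (x + s • (y - x)))
    (fun t => inner ℝ (G (x + t • (y - x))) (y - x)) one_pos
    (fun t _ => (HasGradientAt.hasDerivAt_comp_line hG x (y - x) t).continuousAt.continuousWithinAt)
    (fun t _ => HasGradientAt.hasDerivAt_comp_line hG x (y - x) t)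
  refine ⟨t, ht, ?_⟩
  rw [h]; simp

/-- The first-order lower bound for a function with a `μ`-strongly monotone gradient. -/
lemma HasGradientAt.add_inner_add_sq_le {μ : ℝ} (hG : ∀ x, HasGradientAt f (G x) x)
    (hμ : ∀ x y, μ * ‖x - y‖ ^ 2 ≤ inner ℝ (G x - G y) (x - y)) (x y : E) :
    f x + inner ℝ (G x) (y - x) + μ / 2 * ‖y - x‖ ^ 2 ≤ f y := by
  set v := y - x with hv
  -- Subtracting the quadratic before applying the mean value theorem yields the sharp constant `μ /
  -- 2`: strong monotonicity between `x + t v` and `x` keeps the derivative above `inner (G x) v`.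
  have hd : ∀ t : ℝ, HasDerivAt (fun s : ℝ => f (x + s • v) - μ / 2 * ‖v‖ ^ 2 * s ^ 2)
      (inner ℝ (G (x + t • v)) v - μ * ‖v‖ ^ 2 * t) t := fun t => by
    have h2 := ((hasDerivAt_id t).pow 2).const_mul (μ / 2 * ‖v‖ ^ 2)
    refine ((HasGradientAt.hasDerivAt_comp_line hG x v t).sub h2).congr_deriv ?_
    simp
    ring
  obtain ⟨t, ht, h⟩ := exists_hasDerivAt_eq_slope _ _ one_pos
    (fun t _ => (hd t).continuousAt.continuousWithinAt) (fun t _ => hd t)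
  have h1 := hμ (x + t • v) x
  rw [add_sub_cancel_left, norm_smul, inner_smul_right, inner_sub_left, Real.norm_eq_abs,
    abs_of_pos ht.1] at h1
  have h2 : t * (μ * ‖v‖ ^ 2 * t) ≤ t * (inner ℝ (G (x + t • v)) v - inner ℝ (G x) v) := by
    linarith
  have h3 := le_of_mul_le_mul_left h2 ht.1
  have h4 : x + v = y := by rw [hv]; abel
  simp [h4] at h
  linarith

lemma HasGradientAt.convexOn_of_monotone (hG : ∀ x, HasGradientAt f (G x) x)
    (hμ : ∀ x y, 0 ≤ inner ℝ (G x - G y) (x - y)) : ConvexOn ℝ Set.univ f := by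
  refine ⟨convex_univ, fun x _ y _ a b ha hb hab => ?_⟩
  set z := a • x + b • y with hz
  have hm : ∀ x y, (0 : ℝ) * ‖x - y‖ ^ 2 ≤ inner ℝ (G x - G y) (x - y) := fun x y => by
    rw [zero_mul]; exact hμ x y
  have h1 := HasGradientAt.add_inner_add_sq_le hG hm z x
  have h2 := HasGradientAt.add_inner_add_sq_le hG hm z y
  have h3 : a * inner ℝ (G z) (x - z) + b * inner ℝ (G z) (y - z) = 0 := by
    rw [← inner_smul_right, ← inner_smul_right, ← inner_add_right]
    have : a • (x - z) + b • (y - z) = 0 := by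
      have : a • (x - z) + b • (y - z) = (a • x + b • y) - (a + b) • z := by module
      rw [this, hab, one_smul, sub_self]
    rw [this, inner_zero_right]
  have h4 := mul_le_mul_of_nonneg_left h1 ha
  have h5 := mul_le_mul_of_nonneg_left h2 hb
  have h6 : a * f z + b * f z = f z := by rw [← add_mul, hab, one_mul]
  simp only [smul_eq_mul]
  linarith

/-- Quadratic growth of a smooth function at a critical point. -/
lemma HasGradientAt.sub_le_of_eq_zero {L : ℝ} (hG : ∀ x, HasGradientAt f (G x) x) (hL0 : 0 ≤ L)
    {z : E} (hL : ∀ x, ‖G x - G z‖ ≤ L * ‖x - z‖) (hz : G z = 0) (x : E) :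
    f x - f z ≤ L * ‖x - z‖ ^ 2 := by
  obtain ⟨t, ht, h⟩ := HasGradientAt.exists_sub_eq_inner hG z x
  rw [h]
  have h1 := hL (z + t • (x - z))
  rw [hz, sub_zero, add_sub_cancel_left, norm_smul, Real.norm_eq_abs, abs_of_pos ht.1] at h1
  calc _ ≤ ‖G (z + t • (x - z))‖ * ‖x - z‖ := real_inner_le_norm _ _
    _ ≤ (L * (t * ‖x - z‖)) * ‖x - z‖ := by gcongr
    _ ≤ (L * (1 * ‖x - z‖)) * ‖x - z‖ := by gcongr; exact ht.2.le
    _ = _ := by ring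

/-- Sublevel sets are bounded, with an explicit radius, because the quadratic term dominates the
linear one far from `x`. This gives both the existence of minimizers and the boundedness of the
Tikhonov path. -/
lemma HasGradientAt.norm_sub_le_of_le {μ : ℝ} (hμ0 : 0 < μ) (hG : ∀ x, HasGradientAt f (G x) x)
    (hμ : ∀ x y, μ * ‖x - y‖ ^ 2 ≤ inner ℝ (G x - G y) (x - y)) {x y : E} (h : f y ≤ f x) :
    ‖y - x‖ ≤ 2 * ‖G x‖ / μ := by
  have h1 := HasGradientAt.add_inner_add_sq_le hG hμ x y
  have h2 := neg_le_of_abs_le (abs_real_inner_le_norm (G x) (y - x))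
  rw [le_div_iff₀ hμ0]
  by_contra! h3
  have h4 : 0 < ‖y - x‖ := by
    by_contra! h5
    have : ‖y - x‖ = 0 := le_antisymm h5 (norm_nonneg _)
    rw [this] at h3
    linarith [norm_nonneg (G x)]
  nlinarith

/-- Complete the square in the first-order lower bound at `0`. -/
lemma HasGradientAt.exists_lower_bound {μ : ℝ} (hμ0 : 0 < μ) (hG : ∀ x, HasGradientAt f (G x) x)
    (hμ : ∀ x y, μ * ‖x - y‖ ^ 2 ≤ inner ℝ (G x - G y) (x - y)) : ∃ c, ∀ y, c ≤ f y := by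
  refine ⟨f 0 - ‖G 0‖ ^ 2 / (2 * μ), fun y => ?_⟩
  have h1 := HasGradientAt.add_inner_add_sq_le hG hμ 0 y
  have h2 := neg_le_of_abs_le (abs_real_inner_le_norm (G 0) (y - 0))
  have h3 : 0 ≤ (‖G 0‖ - μ * ‖y - 0‖) ^ 2 / (2 * μ) := by positivity
  have h4 : (‖G 0‖ - μ * ‖y - 0‖) ^ 2 / (2 * μ)
      = ‖G 0‖ ^ 2 / (2 * μ) - ‖G 0‖ * ‖y - 0‖ + μ / 2 * ‖y - 0‖ ^ 2 := by
    field_simp; ring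
  linarith

lemma HasGradientAt.continuous_of_forall (hG : ∀ x, HasGradientAt f (G x) x) : Continuous f :=
  continuous_iff_continuousAt.2 fun x => (hG x).continuousAt

lemma HasGradientAt.eq_zero_of_forall_le {z : E} (hG : HasGradientAt f (G z) z)
    (hz : ∀ y, f z ≤ f y) : G z = 0 := by
  have h := IsLocalMin.hasFDerivAt_eq_zero (f := f) (Eventually.of_forall hz) hG.hasFDerivAt
  simpa using h

lemma HasGradientAt.exists_min_on [FiniteDimensional ℝ E] {μ : ℝ} (hμ0 : 0 < μ)
    (hG : ∀ x, HasGradientAt f (G x) x)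
    (hμ : ∀ x y, μ * ‖x - y‖ ^ 2 ≤ inner ℝ (G x - G y) (x - y)) {S : Set E} (hS : IsClosed S)
    (hne : S.Nonempty) : ∃ z, IsOptimalOn f S z := by
  obtain ⟨x, hx⟩ := hne
  have : ProperSpace E := FiniteDimensional.proper ℝ E
  obtain ⟨z, hz, hmin⟩ := ((isCompact_closedBall x (2 * ‖G x‖ / μ)).inter_right hS).exists_isMinOn
    ⟨x, Metric.mem_closedBall_self (by positivity), hx⟩
    (HasGradientAt.continuous_of_forall hG).continuousOn
  refine ⟨z, hz.2, fun y hy => ?_⟩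
  by_cases h : f y ≤ f x
  · refine hmin ⟨?_, hy⟩
    rw [mem_closedBall_iff_norm]
    exact HasGradientAt.norm_sub_le_of_le hμ0 hG hμ h
  · have := hmin ⟨Metric.mem_closedBall_self (by positivity), hx⟩
    exact le_trans this (not_le.1 h).le

/-- At the midpoint `w` of two minimizers the linear terms cancel, so strong convexity would make `f
w` smaller unless they coincide. -/
lemma HasGradientAt.isOptimalOn_unique {μ : ℝ} (hμ0 : 0 < μ)
    (hG : ∀ x, HasGradientAt f (G x) x)
    (hμ : ∀ x y, μ * ‖x - y‖ ^ 2 ≤ inner ℝ (G x - G y) (x - y)) {S : Set E} (hS : Convex ℝ S)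
    {x y : E} (hx : IsOptimalOn f S x) (hy : IsOptimalOn f S y) : x = y := by
  set w := (1 / 2 : ℝ) • x + (1 / 2 : ℝ) • y with hw
  have hwS : w ∈ S := hS hx.1 hy.1 (by norm_num) (by norm_num) (by norm_num)
  have h1 := HasGradientAt.add_inner_add_sq_le hG hμ w x
  have h2 := HasGradientAt.add_inner_add_sq_le hG hμ w y
  have h3 : inner ℝ (G w) (x - w) + inner ℝ (G w) (y - w) = 0 := by
    rw [← inner_add_right]
    have : x - w + (y - w) = 0 := by rw [hw]; module
    rw [this, inner_zero_right]
  have h4 := hx.2 w hwS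
  have h5 := hy.2 w hwS
  have hx0 : 0 ≤ μ / 2 * ‖x - w‖ ^ 2 := by positivity
  have hy0 : 0 ≤ μ / 2 * ‖y - w‖ ^ 2 := by positivity
  have h6 : μ / 2 * ‖x - w‖ ^ 2 = 0 := by linarith
  have h8 : ‖x - w‖ = 0 := by
    have := (mul_eq_zero.1 h6).resolve_left (by positivity)
    simpa using this
  have h9 : x - w = (1 / 2 : ℝ) • (x - y) := by rw [hw]; module
  rw [h9] at h8
  simpa [sub_eq_zero] using h8

end Convex

/-! ### Strongly monotone maps and the Tikhonov path -/

section Monotone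

variable {E : Type*} [NormedAddCommGroup E] [InnerProductSpace ℝ E]

/-- A gradient step along a strongly monotone Lipschitz map contracts towards its zero. -/
lemma norm_sub_smul_sub_le {Φ : E → E} {μ L β : ℝ} {x z : E} (hz : Φ z = 0)
    (hμ : μ * ‖x - z‖ ^ 2 ≤ inner ℝ (Φ x - Φ z) (x - z))
    (hL : ‖Φ x - Φ z‖ ≤ L * ‖x - z‖) (hβ : 0 ≤ β) (hβL : β * L ^ 2 ≤ μ) (hβμ : β * μ ≤ 2) :
    ‖x - β • Φ x - z‖ ≤ (1 - β * μ / 2) * ‖x - z‖ := by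
  rw [hz, sub_zero] at hμ hL
  have h0 : 0 ≤ 1 - β * μ / 2 := by linarith
  refine le_of_sq_le_sq ?_ (by positivity)
  have e : x - β • Φ x - z = (x - z) - β • Φ x := by abel
  rw [e, norm_sub_sq_real, inner_smul_right, norm_smul, Real.norm_eq_abs, mul_pow, sq_abs,
    real_inner_comm]
  have h1 : ‖Φ x‖ ^ 2 ≤ L ^ 2 * ‖x - z‖ ^ 2 := by
    rw [← mul_pow]
    gcongr
  -- The step-size condition makes the second-order term at most half of the gain `2 β μ ‖x - z‖²`.
  -- What remains is the factor `1 - β μ ≤ (1 - β μ / 2)²`.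
  have h2 : β ^ 2 * ‖Φ x‖ ^ 2 ≤ β * μ * ‖x - z‖ ^ 2 := by
    calc β ^ 2 * ‖Φ x‖ ^ 2 ≤ β ^ 2 * (L ^ 2 * ‖x - z‖ ^ 2) := by gcongr
      _ = β * (β * L ^ 2) * ‖x - z‖ ^ 2 := by ring
      _ ≤ _ := by gcongr
  have h3 := mul_le_mul_of_nonneg_left hμ hβ
  have h4 : 0 ≤ (β * μ / 2 * ‖x - z‖) ^ 2 := by positivity
  nlinarith

/-- The dependence of the regularized solution on the regularization parameter. -/
lemma norm_sub_le_of_regularized {Gf Gg : E → E} {μ l l' : ℝ} {z z' : E} (hl : 0 < l)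
    (hμ0 : 0 < μ)
    (hf : μ * ‖z - z'‖ ^ 2 ≤ inner ℝ (Gf z - Gf z') (z - z'))
    (hg : 0 ≤ inner ℝ (Gg z - Gg z') (z - z'))
    (hz : Gg z + l • Gf z = 0) (hz' : Gg z' + l' • Gf z' = 0) :
    ‖z - z'‖ ≤ |l - l'| / l * (‖Gf z'‖ / μ) := by
  -- The difference of the two optimality equations, paired with `z - z'`; monotonicity of `Gg` then
  -- lets its term be dropped.
  have h1 : inner ℝ (Gg z - Gg z') (z - z') + l * inner ℝ (Gf z - Gf z') (z - z')
      = (l' - l) * inner ℝ (Gf z') (z - z') := by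
    rw [← real_inner_smul_left, ← real_inner_smul_left, ← inner_add_left]
    congr 1
    rw [eq_neg_of_add_eq_zero_left hz, eq_neg_of_add_eq_zero_left hz']
    module
  have h2 : l * (μ * ‖z - z'‖ ^ 2) ≤ |l - l'| * (‖Gf z'‖ * ‖z - z'‖) := by
    calc l * (μ * ‖z - z'‖ ^ 2) ≤ l * inner ℝ (Gf z - Gf z') (z - z') := by gcongr
      _ ≤ (l' - l) * inner ℝ (Gf z') (z - z') := by linarith
      _ ≤ |(l' - l) * inner ℝ (Gf z') (z - z')| := le_abs_self _
      _ ≤ _ := by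
          rw [abs_mul, abs_sub_comm]
          gcongr
          exact abs_real_inner_le_norm _ _
  rcases (norm_nonneg (z - z')).eq_or_lt with h | h
  · rw [← h]; positivity
  · rw [div_mul_div_comm, le_div_iff₀ (by positivity)]
    refine le_of_mul_le_mul_right ?_ h
    linarith

end Monotone

/-- The Tikhonov path tends to the solution of the bilevel problem. -/
lemma tendsto_of_regularized {E : Type*} [NormedAddCommGroup E] [ProperSpace E] {f g : E → ℝ}
    (hf : Continuous f) (hg : Continuous g) (hg0 : ∀ x, 0 ≤ g x) {c r : ℝ} (hc : ∀ x, c ≤ f x)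
    {xs : E} (hxs : g xs = 0) (huniq : ∀ y, g y = 0 → f y ≤ f xs → y = xs)
    {l : ℕ → ℝ} (hl0 : ∀ k, 0 < l k) (hl : Tendsto l atTop (𝓝 0)) {z : ℕ → E}
    (hz : ∀ k, g (z k) + l k * f (z k) ≤ g xs + l k * f xs)
    (hb : ∀ k, ‖z k - xs‖ ≤ r) : Tendsto z atTop (𝓝 xs) := by
  have hfz : ∀ k, f (z k) ≤ f xs := fun k => by
    have h1 := hz k
    have h2 := hg0 (z k)
    rw [hxs] at h1
    exact le_of_mul_le_mul_left (by linarith) (hl0 k)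
  have hgz : Tendsto (fun k => g (z k)) atTop (𝓝 0) := by
    refine squeeze_zero (fun k => hg0 _) (g := fun k => l k * (f xs - c)) (fun k => ?_) ?_
    · have h1 := hz k
      rw [hxs] at h1
      have h2 := mul_le_mul_of_nonneg_left (hc (z k)) (hl0 k).le
      linarith
    · simpa using hl.mul_const (f xs - c)
  -- The sequence stays in a compact ball, and any cluster point satisfies `g = 0` and `f ≤ f xs`,
  -- hence equals `xs`.
  refine (isCompact_closedBall xs r).tendsto_nhds_of_unique_mapClusterPt
    (Eventually.of_forall fun k => by rw [mem_closedBall_iff_norm]; exact hb k)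
    fun y _ hy => huniq y ?_ ?_
  · have h1 : MapClusterPt (g y) atTop (g ∘ z) := hy.continuousAt_comp hg.continuousAt
    have h2 : Tendsto (g ∘ z) atTop (𝓝 0) := hgz
    have h3 : ClusterPt (g y) (𝓝 0) := ClusterPt.mono h1 h2
    exact eq_of_nhds_neBot h3
  · have hclosed : IsClosed {x | f x ≤ f xs} := isClosed_le hf continuous_const
    exact hclosed.mem_of_mapClusterPt hy (Eventually.of_forall hfz)

/-! ### The infeasibility measures -/

lemma hasGradientAt_of_abs_sub_le {E : Type*} [NormedAddCommGroup E] [InnerProductSpace ℝ E]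
    [CompleteSpace E] {f : E → ℝ} {v x : E} {K : ℝ}
    (h : ∀ y, |f y - f x - inner ℝ v (y - x)| ≤ K * ‖y - x‖ ^ 2) : HasGradientAt f v x := by
  rw [hasGradientAt_iff_isLittleO]
  refine Asymptotics.IsBigO.trans_isLittleO (g := fun y => ‖y - x‖ ^ 2) ?_
    (Asymptotics.isLittleO_pow_sub_sub x one_lt_two)
  refine Asymptotics.IsBigO.of_bound K (Eventually.of_forall fun y => ?_)
  rw [Real.norm_eq_abs, Real.norm_eq_abs, abs_of_nonneg (sq_nonneg ‖y - x‖)]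
  exact h y

lemma isLSmooth_of_hasGradientAt {n : ℕ} {f : EuclideanSpace ℝ (Fin n) → ℝ}
    {G : EuclideanSpace ℝ (Fin n) → EuclideanSpace ℝ (Fin n)} {L : ℝ} (hL0 : 0 < L)
    (hG : ∀ x, HasGradientAt f (G x) x) (hL : ∀ x y, ‖G x - G y‖ ≤ L * ‖x - y‖) :
    IsLSmooth L f := by
  have hgrad : gradient f = G := gradient_eq hG
  have hcont : Continuous G :=
    (LipschitzWith.of_dist_le_mul (K := L.toNNReal) fun x y => by
      rw [dist_eq_norm, dist_eq_norm, Real.coe_toNNReal _ hL0.le]; exact hL x y).continuous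
  refine ⟨hL0, ?_, fun x y => by rw [hgrad]; exact hL x y⟩
  rw [contDiff_one_iff_fderiv]
  refine ⟨fun x => (hG x).differentiableAt, ?_⟩
  rw [← toDual_comp_gradient, hgrad]
  exact (InnerProductSpace.toDual ℝ _).continuous.comp hcont

/-- The first-order remainder of `t ↦ max {0, -t}²`: its sign reflects convexity, its quadratic
bound gives differentiability of the penalty. -/
lemma negPart_sq_sub_bounds (s t : ℝ) :
    0 ≤ (max 0 (-s)) ^ 2 - (max 0 (-t)) ^ 2 + 2 * (max 0 (-t)) * (s - t) ∧
      (max 0 (-s)) ^ 2 - (max 0 (-t)) ^ 2 + 2 * (max 0 (-t)) * (s - t) ≤ (s - t) ^ 2 := by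
  rcases le_total s 0 with hs | hs <;> rcases le_total t 0 with ht | ht
  · rw [max_eq_right (by linarith), max_eq_right (by linarith)]
    constructor <;> nlinarith [sq_nonneg (s - t)]
  · rw [max_eq_right (by linarith), max_eq_left (by linarith)]
    constructor <;> nlinarith [mul_nonneg (neg_nonneg.2 hs) ht]
  · rw [max_eq_left (by linarith), max_eq_right (by linarith)]
    constructor <;> nlinarith [mul_nonneg (neg_nonneg.2 ht) hs]
  · rw [max_eq_left (by linarith), max_eq_left (by linarith)]
    constructor <;> nlinarith [sq_nonneg (s - t)]

lemma abs_negPart_sub_le (s t : ℝ) : |max 0 (-s) - max 0 (-t)| ≤ |s - t| := by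
  have := abs_max_sub_max_le_abs (-s) (-t) 0
  rw [max_comm 0 (-s), max_comm 0 (-t)]
  rwa [show -s - -t = -(s - t) by ring, abs_neg] at this

lemma negPart_sub_mul_nonpos (s t : ℝ) : (max 0 (-s) - max 0 (-t)) * (s - t) ≤ 0 := by
  rcases le_total s t with h | h
  · exact mul_nonpos_of_nonneg_of_nonpos
      (sub_nonneg.2 (max_le_max le_rfl (neg_le_neg h))) (sub_nonpos.2 h)
  · exact mul_nonpos_of_nonpos_of_nonneg
      (sub_nonpos.2 (max_le_max le_rfl (neg_le_neg h))) (sub_nonneg.2 h)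

noncomputable section

variable {m n : ℕ} {p : Fin m → ℕ} (A : ∀ i, Matrix (Fin (p i)) (Fin n) ℝ)
  (b : ∀ i, EuclideanSpace ℝ (Fin (p i))) (J : Finset (Fin n)) (i : Fin m)

/-- The matrix `A i` as a continuous linear map. -/
def constraintMap : EuclideanSpace ℝ (Fin n) →L[ℝ] EuclideanSpace ℝ (Fin (p i)) :=
  LinearMap.toContinuousLinearMap (Matrix.toEuclideanLin (A i))

/-- The gradient of the infeasibility measure. -/
def penaltyGrad (x : EuclideanSpace ℝ (Fin n)) : EuclideanSpace ℝ (Fin n) :=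
  ContinuousLinearMap.adjoint (constraintMap A i) (constraintMap A i x - b i)
    - (1 / (m : ℝ)) • ∑ j ∈ J, (max 0 (-(x j))) • EuclideanSpace.single j (1 : ℝ)

lemma penalty_eq (x : EuclideanSpace ℝ (Fin n)) : penalty A b J i x =
    1 / 2 * ‖constraintMap A i x - b i‖ ^ 2
      + 1 / (2 * (m : ℝ)) * ∑ j ∈ J, (max 0 (-(x j))) ^ 2 := rfl

lemma inner_penaltyGrad (x w : EuclideanSpace ℝ (Fin n)) :
    inner ℝ (penaltyGrad A b J i x) w =
      inner ℝ (constraintMap A i x - b i) (constraintMap A i w)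
        - 1 / (m : ℝ) * ∑ j ∈ J, max 0 (-(x j)) * w j := by
  rw [penaltyGrad, inner_sub_left, ContinuousLinearMap.adjoint_inner_left, real_inner_smul_left,
    sum_inner]
  congr 2
  refine Finset.sum_congr rfl fun j _ => ?_
  rw [real_inner_smul_left, EuclideanSpace.inner_single_left]
  simp

lemma hasGradientAt_penalty (x : EuclideanSpace ℝ (Fin n)) :
    HasGradientAt (penalty A b J i) (penaltyGrad A b J i x) x := by
  refine hasGradientAt_of_abs_sub_le
    (K := ‖constraintMap A i‖ ^ 2 / 2 + 1 / (2 * (m : ℝ)) * J.card) fun y => ?_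
  have hlin : constraintMap A i y - b i
      = (constraintMap A i x - b i) + constraintMap A i (y - x) := by
    rw [map_sub]; abel
  have hsq : ‖constraintMap A i y - b i‖ ^ 2 = ‖constraintMap A i x - b i‖ ^ 2
      + 2 * inner ℝ (constraintMap A i x - b i) (constraintMap A i (y - x))
      + ‖constraintMap A i (y - x)‖ ^ 2 := by
    rw [hlin, norm_add_sq_real]
  have hm : 1 / (m : ℝ) = 1 / (2 * (m : ℝ)) * 2 := by
    rw [one_div, one_div, mul_inv]; ring
  have hsum : ∑ j ∈ J, ((max 0 (-(y j))) ^ 2 - (max 0 (-(x j))) ^ 2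
        + 2 * max 0 (-(x j)) * (y j - x j))
      = ∑ j ∈ J, (max 0 (-(y j))) ^ 2 - ∑ j ∈ J, (max 0 (-(x j))) ^ 2
        + 2 * ∑ j ∈ J, max 0 (-(x j)) * (y - x) j := by
    rw [Finset.sum_add_distrib, Finset.sum_sub_distrib, Finset.mul_sum]
    congr 1
    refine Finset.sum_congr rfl fun j _ => ?_
    simp; ring
  have hexp : penalty A b J i y - penalty A b J i x - inner ℝ (penaltyGrad A b J i x) (y - x)
      = 1 / 2 * ‖constraintMap A i (y - x)‖ ^ 2
        + 1 / (2 * (m : ℝ)) * ∑ j ∈ J, ((max 0 (-(y j))) ^ 2 - (max 0 (-(x j))) ^ 2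
        + 2 * max 0 (-(x j)) * (y j - x j)) := by
    rw [hsum, inner_penaltyGrad, penalty_eq, penalty_eq, hsq, hm]
    ring
  have hterm : ∀ j ∈ J, (max 0 (-(y j))) ^ 2 - (max 0 (-(x j))) ^ 2
        + 2 * max 0 (-(x j)) * (y j - x j) ≤ ‖y - x‖ ^ 2 := fun j _ => by
    refine (negPart_sq_sub_bounds (y j) (x j)).2.trans ?_
    have h1 := PiLp.norm_apply_le (y - x) j
    rw [← sq_abs]
    exact pow_le_pow_left₀ (abs_nonneg _) h1 2
  have h0 : 0 ≤ ∑ j ∈ J, ((max 0 (-(y j))) ^ 2 - (max 0 (-(x j))) ^ 2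
        + 2 * max 0 (-(x j)) * (y j - x j)) :=
    Finset.sum_nonneg fun j _ => (negPart_sq_sub_bounds (y j) (x j)).1
  have h1 := Finset.sum_le_card_nsmul J _ _ hterm
  rw [hexp, abs_of_nonneg (by positivity)]
  have h2 := (constraintMap A i).le_opNorm (y - x)
  rw [nsmul_eq_mul] at h1
  calc _ ≤ 1 / 2 * (‖constraintMap A i‖ * ‖y - x‖) ^ 2
        + 1 / (2 * (m : ℝ)) * (J.card * ‖y - x‖ ^ 2) := by gcongr
    _ = _ := by ring

lemma penaltyGrad_monotone (x y : EuclideanSpace ℝ (Fin n)) :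
    0 ≤ inner ℝ (penaltyGrad A b J i x - penaltyGrad A b J i y) (x - y) := by
  rw [inner_sub_left, inner_penaltyGrad, inner_penaltyGrad]
  have h1 : inner ℝ (constraintMap A i x - b i) (constraintMap A i (x - y))
      - inner ℝ (constraintMap A i y - b i) (constraintMap A i (x - y))
      = ‖constraintMap A i (x - y)‖ ^ 2 := by
    rw [← inner_sub_left, ← real_inner_self_eq_norm_sq, sub_sub_sub_cancel_right, ← map_sub]
  have h2 : ∑ j ∈ J, max 0 (-(x j)) * (x - y) j - ∑ j ∈ J, max 0 (-(y j)) * (x - y) j ≤ 0 := by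
    rw [← Finset.sum_sub_distrib]
    refine Finset.sum_nonpos fun j _ => ?_
    rw [← sub_mul]
    exact negPart_sub_mul_nonpos (x j) (y j)
  have h3 : 0 ≤ 1 / (m : ℝ) := by positivity
  nlinarith [sq_nonneg ‖constraintMap A i (x - y)‖]

lemma exists_penaltyGrad_lipschitz : ∃ L : ℝ, 0 ≤ L ∧
    ∀ x y, ‖penaltyGrad A b J i x - penaltyGrad A b J i y‖ ≤ L * ‖x - y‖ := by
  refine ⟨‖ContinuousLinearMap.adjoint (constraintMap A i)‖ * ‖constraintMap A i‖
    + 1 / (m : ℝ) * J.card, by positivity, fun x y => ?_⟩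
  have e : penaltyGrad A b J i x - penaltyGrad A b J i y =
      ContinuousLinearMap.adjoint (constraintMap A i) (constraintMap A i (x - y))
      - (1 / (m : ℝ)) • ∑ j ∈ J, (max 0 (-(x j)) - max 0 (-(y j)))
        • EuclideanSpace.single j (1 : ℝ) := by
    simp only [penaltyGrad, sub_smul, Finset.sum_sub_distrib, smul_sub, map_sub]
    abel
  have h1 : ‖∑ j ∈ J, (max 0 (-(x j)) - max 0 (-(y j))) • EuclideanSpace.single j (1 : ℝ)‖
      ≤ J.card * ‖x - y‖ := by
    refine (norm_sum_le _ _).trans ?_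
    rw [← nsmul_eq_mul]
    refine Finset.sum_le_card_nsmul J _ _ fun j _ => ?_
    rw [norm_smul, PiLp.norm_single, norm_one, mul_one]
    exact (abs_negPart_sub_le _ _).trans (PiLp.norm_apply_le (x - y) j)
  rw [e]
  refine (norm_sub_le _ _).trans ?_
  rw [norm_smul, Real.norm_of_nonneg (by positivity), add_mul, mul_assoc, mul_assoc]
  gcongr
  exact ((ContinuousLinearMap.adjoint (constraintMap A i)).le_opNorm _).trans
    (by gcongr; exact (constraintMap A i).le_opNorm _)

lemma penalty_nonneg (x : EuclideanSpace ℝ (Fin n)) : 0 ≤ penalty A b J i x := by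
  unfold penalty; positivity

lemma exists_penalty_isLSmooth : ∃ L : ℝ, ∀ i, ConvexOn ℝ Set.univ (penalty A b J i) ∧
    IsLSmooth L (penalty A b J i) := by
  choose L hL0 hL using exists_penaltyGrad_lipschitz A b J
  have hle : ∀ i, L i ≤ ∑ i, L i + 1 := fun i => by
    have := Finset.single_le_sum (f := L) (fun i _ => hL0 i) (Finset.mem_univ i)
    linarith
  have hpos : 0 ≤ ∑ i, L i := Finset.sum_nonneg fun i _ => hL0 i
  refine ⟨∑ i, L i + 1, fun i => ⟨?_, ?_⟩⟩
  · exact HasGradientAt.convexOn_of_monotone (hasGradientAt_penalty A b J i)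
      (penaltyGrad_monotone A b J i)
  · refine isLSmooth_of_hasGradientAt (by positivity) (hasGradientAt_penalty A b J i)
      fun x y => (hL i x y).trans ?_
    gcongr
    exact hle i

lemma totalFun_penalty_nonneg (x : EuclideanSpace ℝ (Fin n)) : 0 ≤ totalFun (penalty A b J) x :=
  Finset.sum_nonneg fun i _ => penalty_nonneg A b J i x

lemma totalFun_penalty_eq_zero_iff (hm : 0 < m) (x : EuclideanSpace ℝ (Fin n)) :
    totalFun (penalty A b J) x = 0 ↔ x ∈ linFeasible A b J := by
  have hm' : (0 : ℝ) < m := by exact_mod_cast hm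
  rw [totalFun, Finset.sum_eq_zero_iff_of_nonneg fun i _ => penalty_nonneg A b J i x]
  constructor
  · intro h
    have h' : ∀ i, ‖Matrix.toEuclideanLin (A i) x - b i‖ ^ 2 = 0 ∧
        ∑ j ∈ J, (max 0 (-(x j))) ^ 2 = 0 := fun i => by
      have h1 := h i (Finset.mem_univ i)
      rw [penalty] at h1
      have h2 : 0 ≤ ‖Matrix.toEuclideanLin (A i) x - b i‖ ^ 2 := by positivity
      have h3 : 0 ≤ 1 / (2 * (m : ℝ)) * ∑ j ∈ J, (max 0 (-(x j))) ^ 2 := by positivity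
      refine ⟨by linarith, ?_⟩
      have h4 : 1 / (2 * (m : ℝ)) * ∑ j ∈ J, (max 0 (-(x j))) ^ 2 = 0 := by linarith
      exact (mul_eq_zero.1 h4).resolve_left (by positivity)
    refine ⟨fun i => ?_, fun j hj => ?_⟩
    · have := (h' i).1
      simpa [sub_eq_zero] using this
    · have h1 := (Finset.sum_eq_zero_iff_of_nonneg fun j _ => sq_nonneg _).1 (h' ⟨0, hm⟩).2 j hj
      have h2 : max 0 (-(x j)) = 0 := by simpa using h1
      have h3 := le_max_right 0 (-(x j))
      linarith
  · intro h i _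
    rw [penalty, h.1 i, Finset.sum_eq_zero fun j hj => by
      rw [max_eq_left (by linarith [h.2 j hj])]; simp]
    simp

/-- A nonnegative function that vanishes somewhere is minimized exactly on its zero set. -/
lemma argminSet_penalty (hm : 0 < m) (hfeas : (linFeasible A b J).Nonempty) :
    argminSet (totalFun (penalty A b J)) = linFeasible A b J := by
  obtain ⟨x0, hx0⟩ := hfeas
  ext x
  rw [← totalFun_penalty_eq_zero_iff A b J hm]
  constructor
  · intro h
    refine le_antisymm ((h x0).trans_eq ?_) (totalFun_penalty_nonneg A b J x)
    rwa [totalFun_penalty_eq_zero_iff A b J hm]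
  · intro h y
    rw [h]
    exact totalFun_penalty_nonneg A b J y

lemma convex_linFeasible : Convex ℝ (linFeasible A b J) := by
  intro x hx y hy s t hs ht hst
  refine ⟨fun i => ?_, fun j hj => ?_⟩
  · rw [map_add, map_smul, map_smul, hx.1 i, hy.1 i, ← add_smul, hst, one_smul]
  · have h1 := mul_nonneg hs (hx.2 j hj)
    have h2 := mul_nonneg ht (hy.2 j hj)
    simpa using add_nonneg h1 h2

lemma continuous_totalFun_penalty : Continuous (totalFun (penalty A b J)) :=
  continuous_finsetSum _ fun i _ =>
    HasGradientAt.continuous_of_forall (hasGradientAt_penalty A b J i)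

lemma isClosed_linFeasible (hm : 0 < m) : IsClosed (linFeasible A b J) := by
  have : linFeasible A b J = {x | totalFun (penalty A b J) x = 0} := by
    ext x
    exact (totalFun_penalty_eq_zero_iff A b J hm x).symm
  rw [this]
  exact isClosed_eq (continuous_totalFun_penalty A b J) continuous_const

lemma norm_stack_sq_le (x : EuclideanSpace ℝ (Fin n)) :
    ‖Matrix.toEuclideanLin (stackMatrix A) x - stackVector b‖ ^ 2
      ≤ 2 * totalFun (penalty A b J) x := by
  have h1 : ‖Matrix.toEuclideanLin (stackMatrix A) x - stackVector b‖ ^ 2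
      = ∑ i, ‖Matrix.toEuclideanLin (A i) x - b i‖ ^ 2 := by
    rw [EuclideanSpace.norm_sq_eq, Fintype.sum_sigma]
    refine Finset.sum_congr rfl fun i _ => ?_
    rw [EuclideanSpace.norm_sq_eq]
    rfl
  rw [h1, totalFun, Finset.mul_sum]
  refine Finset.sum_le_sum fun i _ => ?_
  rw [penalty]
  have h3 : 0 ≤ 1 / (2 * (m : ℝ)) * ∑ j ∈ J, (max 0 (-(x j))) ^ 2 := by positivity
  linarith

end

/-! ### One iteration of the push-pull method -/

section Step

open scoped Matrix.Module

variable {m n : ℕ}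

lemma IsRightWeight.le {C : Matrix (Fin m) (Fin m) ℝ} {v : Fin m → ℝ} (hv : IsRightWeight C v)
    (i : Fin m) : v i ≤ m := by
  rw [← hv.sum_eq]
  exact Finset.single_le_sum (fun i _ => hv.nonneg i) (Finset.mem_univ i)

lemma IsRightWeight.transpose {C : Matrix (Fin m) (Fin m) ℝ} {v : Fin m → ℝ}
    (hv : IsRightWeight C v) : IsLeftWeight C.transpose v :=
  ⟨hv.nonneg, by rw [Matrix.vecMul_transpose]; exact hv.eigen, hv.sum_eq⟩

/-- Averaging is the action of a rank-one matrix `J`, so the consensus error is `(1 - J) x` and its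
recursion becomes matrix algebra. -/
lemma rankOne_smul_eq (u : Fin m → ℝ) (x : Fin m → EuclideanSpace ℝ (Fin n)) :
    (Matrix.vecMulVec 1 ((m : ℝ)⁻¹ • u) : Matrix (Fin m) (Fin m) ℝ) • x = fun _ => weightedMean u x := by
  ext1 i
  simp [weightedMean, Finset.smul_sum, mul_smul]

lemma rankOne_smul_eq' (v : Fin m → ℝ) (y : Fin m → EuclideanSpace ℝ (Fin n)) :
    (Matrix.vecMulVec ((m : ℝ)⁻¹ • v) 1 : Matrix (Fin m) (Fin m) ℝ) • y = fun i => v i • weightedMean (fun _ => 1) y := by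
  ext1 i
  simp [weightedMean, Finset.smul_sum, mul_smul, smul_comm (v i)]

/-- The consensus error contracts, up to the gradient step. -/
lemma consensus_step {R : Matrix (Fin m) (Fin m) ℝ} (hm : 0 < m) (hrow : ∀ i, ∑ j, R i j = 1)
    {u : Fin m → ℝ} (hu : IsLeftWeight R u) (x d : Fin m → EuclideanSpace ℝ (Fin n)) :
    (fun i => (R • (x - d)) i - weightedMean u (R • (x - d))) =
      (R - Matrix.vecMulVec 1 ((m : ℝ)⁻¹ • u) : Matrix (Fin m) (Fin m) ℝ) •
        ((fun i => x i - weightedMean u x) - d) := by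
  have hm' : (m : ℝ) ≠ 0 := by positivity
  set J : Matrix (Fin m) (Fin m) ℝ := Matrix.vecMulVec 1 ((m : ℝ)⁻¹ • u) with hJ
  have hR1 : Matrix.mulVec R 1 = 1 := by
    ext i; simp [Matrix.mulVec, dotProduct, hrow]
  have hRJ : R * J = J := by rw [hJ, Matrix.mul_vecMulVec, hR1]
  have hJR : J * R = J := by rw [hJ, Matrix.vecMulVec_mul, Matrix.smul_vecMul, hu.eigen]
  have hJ1 : Matrix.mulVec J 1 = 1 := by
    ext i
    simp [hJ, Matrix.mulVec, dotProduct, Matrix.vecMulVec, ← Finset.mul_sum, hu.sum_eq, hm']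
  have hJJ : J * J = J := by
    conv_lhs => rw [hJ, Matrix.mul_vecMulVec, ← hJ, hJ1]
  have h1 : ∀ w : Fin m → EuclideanSpace ℝ (Fin n),
      (fun i => w i - weightedMean u w) = w - J • w := fun w => by
    rw [hJ, rankOne_smul_eq]; rfl
  -- This is `(1 - J) R = R - J` together with `(R - J) J = 0`.
  rw [h1 x, h1 (R • (x - d)), smul_smul, hJR, ← sub_smul, sub_right_comm,
    smul_sub (R - J) (x - d) (J • x), smul_smul, sub_mul, hRJ, hJJ, sub_self, zero_smul, sub_zero]

/-- The tracking error contracts, up to the increment of the local gradients. -/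
lemma tracking_step {C : Matrix (Fin m) (Fin m) ℝ} (hm : 0 < m) (hcol : ∀ j, ∑ i, C i j = 1)
    {v : Fin m → ℝ} (hv : IsRightWeight C v) (y d : Fin m → EuclideanSpace ℝ (Fin n)) :
    (fun i => (C • y + d) i - v i • weightedMean (fun _ => 1) (C • y + d)) =
      (C - Matrix.vecMulVec ((m : ℝ)⁻¹ • v) 1 : Matrix (Fin m) (Fin m) ℝ) •
        (fun i => y i - v i • weightedMean (fun _ => 1) y) +
      (1 - Matrix.vecMulVec ((m : ℝ)⁻¹ • v) 1 : Matrix (Fin m) (Fin m) ℝ) • d := by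
  have hm' : (m : ℝ) ≠ 0 := by positivity
  set J : Matrix (Fin m) (Fin m) ℝ := Matrix.vecMulVec ((m : ℝ)⁻¹ • v) 1 with hJ
  have hC1 : Matrix.vecMul 1 C = 1 := by
    ext i; simp [Matrix.vecMul, dotProduct, hcol]
  have hCJ : C * J = J := by rw [hJ, Matrix.mul_vecMulVec, Matrix.mulVec_smul, hv.eigen]
  have hJC : J * C = J := by rw [hJ, Matrix.vecMulVec_mul, hC1]
  have hJ1 : Matrix.vecMul 1 J = 1 := by
    ext i
    simp [hJ, Matrix.vecMul, dotProduct, Matrix.vecMulVec, ← Finset.mul_sum, hv.sum_eq, hm']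
  have hJJ : J * J = J := by
    conv_lhs => rw [hJ, Matrix.vecMulVec_mul, ← hJ, hJ1]
  have h1 : ∀ w : Fin m → EuclideanSpace ℝ (Fin n),
      (fun i => w i - v i • weightedMean (fun _ => 1) w) = w - J • w := fun w => by
    rw [hJ, rankOne_smul_eq']; rfl
  rw [h1 y, h1 (C • y + d), smul_add, smul_sub, smul_smul, smul_smul, sub_mul, hJC, hCJ, hJJ,
    sub_self, zero_smul, sub_smul, sub_smul, one_smul]
  abel

lemma weightedMean_smul_eq {R : Matrix (Fin m) (Fin m) ℝ} {u : Fin m → ℝ}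
    (hu : IsLeftWeight R u) (w : Fin m → EuclideanSpace ℝ (Fin n)) :
    weightedMean u (R • w) = weightedMean u w := by
  have h1 : ∑ i, u i • (R • w) i = ∑ i, u i • w i := by
    simp only [Matrix.Module.smul_apply, Finset.smul_sum, smul_smul]
    rw [Finset.sum_comm]
    refine Finset.sum_congr rfl fun j _ => ?_
    rw [← Finset.sum_smul]
    congr 1
    exact congrFun hu.eigen j
  rw [weightedMean, h1, weightedMean]

/-- Mixing by `C` conserves the total, which is why the trackers always add up to the sum of the
current local gradients. -/
lemma sum_smul_eq {C : Matrix (Fin m) (Fin m) ℝ} (hcol : ∀ j, ∑ i, C i j = 1)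
    (y : Fin m → EuclideanSpace ℝ (Fin n)) : ∑ i, (C • y) i = ∑ i, y i := by
  simp only [Matrix.Module.smul_apply]
  rw [Finset.sum_comm]
  refine Finset.sum_congr rfl fun j _ => ?_
  rw [← Finset.sum_smul, hcol, one_smul]

lemma norm_step_smul_le {γ : Fin m → ℝ} {g : ℝ} (hγ : ∀ j, 0 ≤ γ j) (hγg : ∀ j, γ j ≤ g)
    (hg : 0 ≤ g) (y : Fin m → EuclideanSpace ℝ (Fin n)) : ‖fun j => γ j • y j‖ ≤ g * ‖y‖ := by
  rw [pi_norm_le_iff_of_nonneg (by positivity)]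
  intro j
  rw [norm_smul, Real.norm_of_nonneg (hγ j)]
  exact mul_le_mul (hγg j) (norm_le_pi_norm y j) (norm_nonneg _) hg

lemma norm_sub_le_add_of_mean (u : Fin m → ℝ) (x : Fin m → EuclideanSpace ℝ (Fin n))
    (z : EuclideanSpace ℝ (Fin n)) (i : Fin m) :
    ‖x i - z‖ ≤ ‖fun i => x i - weightedMean u x‖ + ‖weightedMean u x - z‖ := by
  calc ‖x i - z‖ = ‖(x i - weightedMean u x) + (weightedMean u x - z)‖ := by congr 1; abel
    _ ≤ _ := norm_add_le _ _
    _ ≤ _ := by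
        gcongr
        exact norm_le_pi_norm (fun i => x i - weightedMean u x) i

lemma norm_sum_sub_le {G : Fin m → EuclideanSpace ℝ (Fin n) → EuclideanSpace ℝ (Fin n)} {L D : ℝ}
    (hL : ∀ i x y, ‖G i x - G i y‖ ≤ L * ‖x - y‖) (hL0 : 0 ≤ L)
    {x y : Fin m → EuclideanSpace ℝ (Fin n)} (h : ∀ i, ‖x i - y i‖ ≤ D) :
    ‖∑ i, G i (x i) - ∑ i, G i (y i)‖ ≤ m * L * D := by
  rw [← Finset.sum_sub_distrib]
  calc _ ≤ ∑ i, ‖G i (x i) - G i (y i)‖ := norm_sum_le _ _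
    _ ≤ ∑ _i : Fin m, L * D := Finset.sum_le_sum fun i _ =>
        (hL i _ _).trans (mul_le_mul_of_nonneg_left (h i) hL0)
    _ = _ := by simp; ring

/-- The size of the tracking variables. -/
lemma norm_tracker_le {G : Fin m → EuclideanSpace ℝ (Fin n) → EuclideanSpace ℝ (Fin n)} {L : ℝ}
    (hm : 0 < m) (hL : ∀ i x y, ‖G i x - G i y‖ ≤ L * ‖x - y‖) (hL0 : 0 ≤ L)
    {u v : Fin m → ℝ} (hv0 : ∀ i, 0 ≤ v i) (hv : ∀ i, v i ≤ m)
    {x y : Fin m → EuclideanSpace ℝ (Fin n)} (hy : ∑ i, y i = ∑ i, G i (x i))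
    {z : EuclideanSpace ℝ (Fin n)} (hz : ∑ i, G i z = 0) :
    ‖y‖ ≤ ‖fun i => y i - v i • weightedMean (fun _ => 1) y‖
      + m * L * (‖fun i => x i - weightedMean u x‖ + ‖weightedMean u x - z‖) := by
  have hm' : (0 : ℝ) < m := by exact_mod_cast hm
  have h1 : ‖weightedMean (fun _ => 1) y‖
      ≤ L * (‖fun i => x i - weightedMean u x‖ + ‖weightedMean u x - z‖) := by
    have h2 := norm_sum_sub_le hL hL0 (y := fun _ => z) (norm_sub_le_add_of_mean u x z)
    rw [hz, sub_zero] at h2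
    have h3 : weightedMean (fun _ => 1) y = (1 / (m : ℝ)) • ∑ i, G i (x i) := by
      simp [weightedMean, hy]
    rw [h3, norm_smul, Real.norm_of_nonneg (by positivity)]
    rw [one_div, inv_mul_le_iff₀ hm', ← mul_assoc]
    exact h2
  rw [pi_norm_le_iff_of_nonneg (by positivity)]
  intro i
  calc ‖y i‖ = ‖(y i - v i • weightedMean (fun _ => 1) y)
          + v i • weightedMean (fun _ => 1) y‖ := by congr 1; abel
    _ ≤ _ := norm_add_le _ _
    _ ≤ _ := by
        refine add_le_add
          (norm_le_pi_norm (fun i => y i - v i • weightedMean (fun _ => 1) y) i) ?_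
        rw [norm_smul, Real.norm_of_nonneg (hv0 i), mul_assoc]
        exact mul_le_mul (hv i) h1 (norm_nonneg _) hm'.le

/-- The displacement of the local copies. -/
lemma norm_displacement_le {R : Matrix (Fin m) (Fin m) ℝ} (hR : ∀ i j, 0 ≤ R i j)
    (hrow : ∀ i, ∑ j, R i j = 1) (u : Fin m → ℝ) (x d : Fin m → EuclideanSpace ℝ (Fin n))
    (i : Fin m) :
    ‖(R • (x - d)) i - x i‖ ≤ 2 * ‖fun i => x i - weightedMean u x‖ + ‖d‖ := by
  -- Unit row sums allow `x i` to be moved inside the average.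
  have h1 : (R • (x - d)) i - x i = ∑ j, R i j • (x j - d j - x i) := by
    simp only [smul_sub (R i _), Finset.sum_sub_distrib]
    rw [← Finset.sum_smul, hrow, one_smul]
    simp [smul_sub, Finset.sum_sub_distrib]
  have h2 : ∀ j, ‖x j - d j - x i‖ ≤ 2 * ‖fun i => x i - weightedMean u x‖ + ‖d‖ := fun j => by
    have e : x j - d j - x i = (x j - weightedMean u x) - (x i - weightedMean u x) - d j := by abel
    rw [e]
    have hj := norm_le_pi_norm (fun i => x i - weightedMean u x) j
    have hi := norm_le_pi_norm (fun i => x i - weightedMean u x) i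
    have hd := norm_le_pi_norm d j
    have ha := norm_sub_le ((x j - weightedMean u x) - (x i - weightedMean u x)) (d j)
    have hb := norm_sub_le (x j - weightedMean u x) (x i - weightedMean u x)
    linarith
  rw [h1]
  calc _ ≤ ∑ j, R i j * (2 * ‖fun i => x i - weightedMean u x‖ + ‖d‖) := by
        refine (norm_sum_le _ _).trans (Finset.sum_le_sum fun j _ => ?_)
        rw [norm_smul, Real.norm_of_nonneg (hR i j)]
        exact mul_le_mul_of_nonneg_left (h2 j) (hR i j)
    _ = _ := by rw [← Finset.sum_mul, hrow, one_mul]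

/-- The averaged iterate performs an inexact gradient step. -/
lemma norm_mean_step_le {R : Matrix (Fin m) (Fin m) ℝ} (hm : 0 < m) {u v γ : Fin m → ℝ}
    (hu : IsLeftWeight R u) (hv0 : ∀ i, 0 ≤ v i) (hv : ∀ i, v i ≤ m)
    {G : Fin m → EuclideanSpace ℝ (Fin n) → EuclideanSpace ℝ (Fin n)} {L M g θ : ℝ}
    (hL : ∀ i x y, ‖G i x - G i y‖ ≤ L * ‖x - y‖) (hL0 : 0 ≤ L)
    (hγ : ∀ j, 0 ≤ γ j) (hγg : ∀ j, γ j ≤ g) (hM0 : 0 ≤ M)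
    (hM : ∀ x y, m * M * ‖x - y‖ ^ 2 ≤ inner ℝ (∑ i, G i x - ∑ i, G i y) (x - y))
    (hθ : θ * g ≤ 1 / (m : ℝ) * ∑ j, u j * γ j * v j) (hg : 0 ≤ g)
    (hgL : g * m * L ^ 2 ≤ M) (hgM : g * m * M ≤ 2)
    {x y : Fin m → EuclideanSpace ℝ (Fin n)} (hy : ∑ i, y i = ∑ i, G i (x i))
    {z : EuclideanSpace ℝ (Fin n)} (hz : ∑ i, G i z = 0) :
    ‖weightedMean u (R • (x - fun j => γ j • y j)) - z‖ ≤
      (1 - θ * g * M / 2) * ‖weightedMean u x - z‖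
        + g * (m * L * ‖fun i => x i - weightedMean u x‖
          + ‖fun i => y i - v i • weightedMean (fun _ => 1) y‖) := by
  have hm' : (0 : ℝ) < m := by exact_mod_cast hm
  set α := 1 / (m : ℝ) * ∑ j, u j * γ j * v j with hα
  -- The effective step along the summed gradient: replacing each `y j` by its consensus value `v j
  -- • ȳ` produces `α • ȳ`, and `ȳ` is `1 / m` times that sum.
  set β := α / m with hβ
  set xb := weightedMean u x with hxb
  set Y : Fin m → EuclideanSpace ℝ (Fin n) :=
    fun i => y i - v i • weightedMean (fun _ => 1) y with hY
  have hα0 : 0 ≤ α := mul_nonneg (by positivity)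
    (Finset.sum_nonneg fun j _ => mul_nonneg (mul_nonneg (hu.nonneg j) (hγ j)) (hv0 j))
  have hβ0 : 0 ≤ β := by positivity
  have hsumu : 1 / (m : ℝ) * ∑ j, u j = 1 := by
    rw [hu.sum_eq]; field_simp
  have hβg : β ≤ g := by
    rw [hβ, div_le_iff₀ hm']
    calc α ≤ 1 / (m : ℝ) * ∑ j, u j * (g * m) := by
          rw [hα]
          refine mul_le_mul_of_nonneg_left (Finset.sum_le_sum fun j _ => ?_) (by positivity)
          rw [mul_assoc]
          exact mul_le_mul_of_nonneg_left (mul_le_mul (hγg j) (hv j) (hv0 j) hg) (hu.nonneg j)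
      _ = (1 / (m : ℝ) * ∑ j, u j) * (g * m) := by rw [← Finset.sum_mul, mul_assoc]
      _ = g * m := by rw [hsumu, one_mul]
  -- An exact gradient step at the average, plus the error of evaluating gradients at the local
  -- copies, minus the tracking error.
  have hdecomp : weightedMean u (R • (x - fun j => γ j • y j)) - z =
      (xb - β • ∑ i, G i xb - z) + β • (∑ i, G i xb - ∑ i, G i (x i))
        - (1 / (m : ℝ)) • ∑ j, (u j * γ j) • Y j := by
    rw [weightedMean_smul_eq hu]
    have e1 : weightedMean u (x - fun j => γ j • y j)
        = xb - (1 / (m : ℝ)) • ∑ j, (u j * γ j) • y j := by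
      simp [hxb, weightedMean, smul_sub, Finset.sum_sub_distrib, mul_smul]
    have e2 : ∑ j, (u j * γ j) • y j
        = ∑ j, (u j * γ j) • Y j + (∑ j, u j * γ j * v j) • weightedMean (fun _ => 1) y := by
      rw [Finset.sum_smul, ← Finset.sum_add_distrib]
      refine Finset.sum_congr rfl fun j _ => ?_
      rw [hY]
      simp only [smul_sub, mul_smul]
      abel
    have e3 : weightedMean (fun _ => 1) y = (1 / (m : ℝ)) • ∑ i, G i (x i) := by
      simp [weightedMean, hy]
    have e4 : (1 / (m : ℝ)) • (∑ j, u j * γ j * v j) • weightedMean (fun _ => 1) y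
        = β • ∑ i, G i (x i) := by
      rw [e3, smul_smul, smul_smul, hβ, hα]
      congr 1
      ring
    rw [e1, e2, smul_add, e4, smul_sub]
    abel
  have hM' := hM xb z
  have hLs : ‖∑ i, G i xb - ∑ i, G i z‖ ≤ m * L * ‖xb - z‖ :=
    norm_sum_sub_le hL hL0 (x := fun _ => xb) (y := fun _ => z) fun _ => le_rfl
  have hstep := norm_sub_smul_sub_le (Φ := fun w => ∑ i, G i w) (β := β) hz hM' hLs hβ0
    (by
      calc β * (m * L) ^ 2 ≤ g * (m * L) ^ 2 := by gcongr
        _ = m * (g * m * L ^ 2) := by ring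
        _ ≤ m * M := by gcongr)
    (by
      calc β * (m * M) ≤ g * (m * M) := by gcongr
        _ ≤ 2 := by linarith)
  have hY' : ‖(1 / (m : ℝ)) • ∑ j, (u j * γ j) • Y j‖ ≤ g * ‖Y‖ := by
    rw [norm_smul, Real.norm_of_nonneg (by positivity)]
    calc _ ≤ 1 / (m : ℝ) * ∑ j, u j * (g * ‖Y‖) := by
          refine mul_le_mul_of_nonneg_left ((norm_sum_le _ _).trans
            (Finset.sum_le_sum fun j _ => ?_)) (by positivity)
          rw [norm_smul, Real.norm_of_nonneg (mul_nonneg (hu.nonneg j) (hγ j)), mul_assoc]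
          exact mul_le_mul_of_nonneg_left
            (mul_le_mul (hγg j) (norm_le_pi_norm Y j) (norm_nonneg _) hg) (hu.nonneg j)
      _ = (1 / (m : ℝ) * ∑ j, u j) * (g * ‖Y‖) := by rw [← Finset.sum_mul, mul_assoc]
      _ = g * ‖Y‖ := by rw [hsumu, one_mul]
  have hG' : ‖β • (∑ i, G i xb - ∑ i, G i (x i))‖
      ≤ g * (m * L * ‖fun i => x i - xb‖) := by
    rw [norm_smul, Real.norm_of_nonneg hβ0]
    refine mul_le_mul hβg ?_ (norm_nonneg _) hg
    refine norm_sum_sub_le hL hL0 (x := fun _ => xb) fun i => ?_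
    rw [norm_sub_rev]
    exact norm_le_pi_norm (fun i => x i - xb) i
  -- The summed map has modulus `m M`, so the factors `m` cancel and the lower bound on the weighted
  -- step-size applies.
  have hcoef : 1 - β * (m * M) / 2 ≤ 1 - θ * g * M / 2 := by
    have h1 : β * (m * M) = α * M := by rw [hβ]; field_simp
    have h2 := mul_le_mul_of_nonneg_right hθ hM0
    rw [h1]
    linarith
  rw [hdecomp]
  have t1 := norm_sub_le ((xb - β • ∑ i, G i xb - z) + β • (∑ i, G i xb - ∑ i, G i (x i)))
    ((1 / (m : ℝ)) • ∑ j, (u j * γ j) • Y j)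
  have t2 := norm_add_le (xb - β • ∑ i, G i xb - z) (β • (∑ i, G i xb - ∑ i, G i (x i)))
  have t3 := mul_le_mul_of_nonneg_right hcoef (norm_nonneg (xb - z))
  linarith

end Step

/-! ### Rates of the push-pull method -/

section Rates

open scoped Matrix.Module

variable {m n : ℕ}

lemma MixingMatrices.pos {R C : Matrix (Fin m) (Fin m) ℝ} (h : MixingMatrices R C) : 0 < m := by
  obtain ⟨r, -⟩ := h.common_root
  exact r.pos

lemma IsLeftWeight.exists_pow_le {R : Matrix (Fin m) (Fin m) ℝ} (hm : 0 < m)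
    (hR : ∀ i j, 0 ≤ R i j) (hd : ∀ i, 0 < R i i) (hrow : ∀ i, ∑ j, R i j = 1)
    (hr : (treeRoots R).Nonempty) {u : Fin m → ℝ} (hu : IsLeftWeight R u) {η : ℝ} (hη : 0 < η) :
    ∃ N : ℕ, 1 ≤ N ∧ ∀ i j,
      |((R - Matrix.vecMulVec 1 ((m : ℝ)⁻¹ • u) : Matrix (Fin m) (Fin m) ℝ) ^ N) i j| ≤ η := by
  have hm' : (m : ℝ) ≠ 0 := by positivity
  refine exists_pow_sub_rankOne_le hR hd hrow hr ?_ ?_ hη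
  · rw [Matrix.smul_vecMul, hu.eigen]
  · simp [← Finset.mul_sum, hu.sum_eq, hm']

/-- Transposition turns the column-stochastic case into the row-stochastic one. -/
lemma IsRightWeight.exists_pow_le {C : Matrix (Fin m) (Fin m) ℝ} (hm : 0 < m)
    (hC : ∀ i j, 0 ≤ C i j) (hd : ∀ i, 0 < C i i) (hcol : ∀ j, ∑ i, C i j = 1)
    (hr : (treeRoots C.transpose).Nonempty) {v : Fin m → ℝ} (hv : IsRightWeight C v) {η : ℝ}
    (hη : 0 < η) : ∃ N : ℕ, 1 ≤ N ∧ ∀ i j,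
      |((C - Matrix.vecMulVec ((m : ℝ)⁻¹ • v) 1 : Matrix (Fin m) (Fin m) ℝ) ^ N) i j| ≤ η := by
  obtain ⟨N, hN1, hN⟩ := hv.transpose.exists_pow_le (R := C.transpose) hm (fun i j => hC j i) hd hcol hr hη
  refine ⟨N, hN1, fun i j => ?_⟩
  have h1 : (C.transpose - Matrix.vecMulVec 1 ((m : ℝ)⁻¹ • v) : Matrix (Fin m) (Fin m) ℝ) =
      (C - Matrix.vecMulVec ((m : ℝ)⁻¹ • v) 1 : Matrix (Fin m) (Fin m) ℝ).transpose := by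
    rw [Matrix.transpose_sub, Matrix.transpose_vecMulVec]
  have h2 := hN j i
  rwa [h1, ← Matrix.transpose_pow, Matrix.transpose_apply] at h2

lemma regParam_pos {l0 b : ℝ} (hl0 : 0 < l0) (k : ℕ) : 0 < regParam l0 b k := by
  unfold regParam; positivity

lemma regParam_le {l0 b : ℝ} (hl0 : 0 < l0) (hb : 0 ≤ b) (k : ℕ) : regParam l0 b k ≤ l0 :=
  div_le_self hl0.le (Real.one_le_rpow (by linarith [Nat.cast_nonneg (α := ℝ) k]) hb)

lemma regParam_succ_le {l0 b : ℝ} (hl0 : 0 < l0) (hb : 0 ≤ b) (k : ℕ) :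
    regParam l0 b (k + 1) ≤ regParam l0 b k := by
  have := mul_le_mul_of_nonneg_left (one_div_rpow_succ_le hb k) hl0.le
  simpa [regParam, div_eq_mul_inv] using this

/-- The relative decrease is at most `1 / (k + 1)`; this is the source of the `1/k` perturbations.
-/
lemma regParam_sub_succ_le {l0 b : ℝ} (hl0 : 0 < l0) (hb : b ≤ 1) (k : ℕ) :
    regParam l0 b k - regParam l0 b (k + 1) ≤ 1 / ((k : ℝ) + 1) * regParam l0 b k := by
  have := mul_le_mul_of_nonneg_left (one_div_rpow_sub_succ_le hb k) hl0.le
  have e : ∀ t : ℝ, l0 / t = l0 * (1 / t) := fun t => by ring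
  unfold regParam
  rw [e, e, ← mul_sub]
  linarith

set_option maxHeartbeats 1000000 in
/-- The errors of the iteratively regularized push-pull method, relative to the path `z` of the
regularized solutions, decay like `1 / k ^ (1 - a - b)`. -/
theorem pushPull_rates {R C : Matrix (Fin m) (Fin m) ℝ} (hRC : MixingMatrices R C)
    {u v : Fin m → ℝ} (hu : IsLeftWeight R u) (hv : IsRightWeight C v)
    {γ : ℕ → Fin m → ℝ} {gam0 lam0 a b : ℝ} (hupd : UpdateRules u v γ gam0 lam0 a b)
    {Gf Gg : Fin m → EuclideanSpace ℝ (Fin n) → EuclideanSpace ℝ (Fin n)} {μ Lf Lg B cz : ℝ}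
    (hμ : 0 < μ) (hLf : 0 ≤ Lf) (hLg : 0 ≤ Lg) (hB : 0 ≤ B) (hcz : 0 ≤ cz)
    (hfL : ∀ i x y, ‖Gf i x - Gf i y‖ ≤ Lf * ‖x - y‖)
    (hgL : ∀ i x y, ‖Gg i x - Gg i y‖ ≤ Lg * ‖x - y‖)
    (hfμ : ∀ i x y, μ * ‖x - y‖ ^ 2 ≤ inner ℝ (Gf i x - Gf i y) (x - y))
    (hgm : ∀ i x y, 0 ≤ inner ℝ (Gg i x - Gg i y) (x - y))
    {x y : ℕ → Fin m → EuclideanSpace ℝ (Fin n)}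
    (hx : ∀ k, x (k + 1) = R • (x k - fun j => γ k j • y k j))
    (hy0 : ∀ i, y 0 i = Gg i (x 0 i) + regParam lam0 b 0 • Gf i (x 0 i))
    (hy : ∀ k, y (k + 1) = C • y k + fun i =>
      (Gg i (x (k + 1) i) + regParam lam0 b (k + 1) • Gf i (x (k + 1) i))
        - (Gg i (x k i) + regParam lam0 b k • Gf i (x k i)))
    {z : ℕ → EuclideanSpace ℝ (Fin n)}
    (hz : ∀ k, ∑ i, (Gg i (z k) + regParam lam0 b k • Gf i (z k)) = 0)
    (hzB : ∀ k i, ‖Gf i (z k)‖ ≤ B)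
    (hzd : ∀ k : ℕ, ‖z k - z (k + 1)‖ ≤ cz * (1 / ((k : ℝ) + 1))) :
    ∃ M : ℝ, 0 ≤ M ∧ ∀ᶠ k : ℕ in atTop,
      ‖weightedMean u (x k) - z k‖ ≤ M * (1 / ((k : ℝ) + 1) ^ (1 - a - b)) ∧
      ‖fun i => x k i - weightedMean u (x k)‖ ≤ M * (1 / ((k : ℝ) + 1) ^ (1 - a - b)) ∧
      ‖fun i => y k i - v i • weightedMean (fun _ => 1) (y k)‖
        ≤ M * (1 / ((k : ℝ) + 1) ^ (1 - a - b)) := by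
  have hm := hRC.pos
  have hm' : (0 : ℝ) < m := by exact_mod_cast hm
  have ha : 0 < a := hupd.b_pos.trans hupd.b_lt_a
  have hl0 := hupd.lam0_pos
  have hg0 := hupd.gam0_pos
  obtain ⟨θ, hθ, hθk⟩ := hupd.weighted
  obtain ⟨σR, cR, PR, hσR0, hσR1, hcR, hPR, hPR', hPRadd, hPRc⟩ :=
    exists_contracting_norm (E := EuclideanSpace ℝ (Fin n)) fun η hη =>
      hu.exists_pow_le hm hRC.R_nonneg hRC.R_diag hRC.R_row
        (hRC.common_root.mono Set.inter_subset_left) hη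
  obtain ⟨σC, cC, PC, hσC0, hσC1, hcC, hPC, hPC', hPCadd, hPCc⟩ :=
    exists_contracting_norm (E := EuclideanSpace ℝ (Fin n)) fun η hη =>
      hv.exists_pow_le hm hRC.C_nonneg hRC.C_diag hRC.C_col
        (hRC.common_root.mono Set.inter_subset_right) hη
  obtain ⟨cI, hcI, hI⟩ := exists_rowSumLe
    (1 - Matrix.vecMulVec ((m : ℝ)⁻¹ • v) 1 : Matrix (Fin m) (Fin m) ℝ)
  set lam : ℕ → ℝ := regParam lam0 b with hlam
  set g : ℕ → ℝ := fun k => gam0 / ((k : ℝ) + 1) ^ a with hg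
  set X : ℕ → Fin m → EuclideanSpace ℝ (Fin n) :=
    fun k i => x k i - weightedMean u (x k) with hX
  set Y : ℕ → Fin m → EuclideanSpace ℝ (Fin n) :=
    fun k i => y k i - v i • weightedMean (fun _ => 1) (y k) with hY
  set d : ℕ → ℝ := fun k => ‖weightedMean u (x k) - z k‖ with hd
  set p : ℕ → ℝ := fun k => PR (X k) with hp
  set q : ℕ → ℝ := fun k => PC (Y k) with hq
  set s : ℕ → ℝ := fun k => p k + q k + d k with hs
  have hlam0 : ∀ k, 0 < lam k := fun k => regParam_pos hl0 k
  have hlamle : ∀ k, lam k ≤ lam0 := fun k => regParam_le hl0 hupd.b_pos.le k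
  have hgpos : ∀ k, 0 < g k := fun k => by positivity
  have hγg : ∀ k j, γ k j ≤ g k := fun k j => (hupd.step_max k).2 ⟨j, rfl⟩
  have hXp : ∀ k, ‖X k‖ ≤ p k := fun k => hPR _
  have hYq : ∀ k, ‖Y k‖ ≤ q k := fun k => hPC _
  have hp0 : ∀ k, 0 ≤ p k := fun k => (norm_nonneg _).trans (hXp k)
  have hq0 : ∀ k, 0 ≤ q k := fun k => (norm_nonneg _).trans (hYq k)
  have hd0 : ∀ k, 0 ≤ d k := fun k => norm_nonneg _
  have hs0 : ∀ k, 0 ≤ s k := fun k => add_nonneg (add_nonneg (hp0 k) (hq0 k)) (hd0 k)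
  set L : ℝ := Lg + lam0 * Lf with hL
  have hL0 : 0 ≤ L := by positivity
  have hGL : ∀ k i x y, ‖(Gg i x + lam k • Gf i x) - (Gg i y + lam k • Gf i y)‖ ≤ L * ‖x - y‖ :=
    fun k i x y => by
      have e : (Gg i x + lam k • Gf i x) - (Gg i y + lam k • Gf i y)
          = (Gg i x - Gg i y) + lam k • (Gf i x - Gf i y) := by rw [smul_sub]; abel
      rw [e, hL, add_mul, mul_assoc]
      refine (norm_add_le _ _).trans (add_le_add (hgL i x y) ?_)
      rw [norm_smul, Real.norm_of_nonneg (hlam0 k).le]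
      exact mul_le_mul (hlamle k) (hfL i x y) (norm_nonneg _) hl0.le
  have hysum : ∀ k, ∑ i, y k i = ∑ i, (Gg i (x k i) + lam k • Gf i (x k i)) := fun k => by
    induction k with
    | zero => exact Finset.sum_congr rfl fun i _ => hy0 i
    | succ k ih =>
      rw [hy k]
      simp only [Pi.add_apply]
      rw [Finset.sum_add_distrib, sum_smul_eq hRC.C_col, ih, Finset.sum_sub_distrib]
      abel
  set K : ℝ := 1 + m * L with hK
  have hK1 : 0 ≤ K := by positivity
  have hynorm : ∀ k, ‖y k‖ ≤ K * s k := fun k => by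
    have h1 := norm_tracker_le hm (hGL k) hL0 (u := u) hv.nonneg hv.le (hysum k) (hz k)
    have h2 : ‖y k‖ ≤ q k + m * L * (p k + d k) := h1.trans (by
      have := hXp k
      have := hYq k
      gcongr)
    have h3 : 0 ≤ m * L * q k := mul_nonneg (by positivity) (hq0 k)
    have : K * s k = q k + m * L * (p k + d k) + (p k + d k + m * L * q k) := by
      simp only [hK, hs]; ring
    have := hp0 k
    have := hd0 k
    linarith
  have hstepn : ∀ k, ‖fun j => γ k j • y k j‖ ≤ g k * (K * s k) := fun k =>
    (norm_step_smul_le (hupd.step_nonneg k) (hγg k) (hgpos k).le (y k)).trans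
      (mul_le_mul_of_nonneg_left (hynorm k) (hgpos k).le)
  -- the consensus error
  have hprec : ∀ k, p (k + 1) ≤ σR * p k + cR * K * g k * s k := fun k => by
    have h1 : X (k + 1) = (R - Matrix.vecMulVec 1 ((m : ℝ)⁻¹ • u) : Matrix (Fin m) (Fin m) ℝ) •
        (X k + -fun j => γ k j • y k j) := by
      rw [← sub_eq_add_neg, ← consensus_step hm hRC.R_row hu, ← hx k]
    have h2 : p (k + 1) ≤ σR * PR (X k + -fun j => γ k j • y k j) := by
      simp only [hp]; rw [h1]; exact hPRc _
    have h3 : PR (X k + -fun j => γ k j • y k j) ≤ p k + cR * (g k * (K * s k)) := by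
      refine (hPRadd _ _).trans (add_le_add le_rfl ((hPR' _).trans ?_))
      rw [norm_neg]
      exact mul_le_mul_of_nonneg_left (hstepn k) hcR
    have h4 : 0 ≤ cR * (g k * (K * s k)) :=
      mul_nonneg hcR (mul_nonneg (hgpos k).le (mul_nonneg hK1 (hs0 k)))
    calc p (k + 1) ≤ σR * (p k + cR * (g k * (K * s k))) :=
          h2.trans (mul_le_mul_of_nonneg_left h3 hσR0)
      _ = σR * p k + σR * (cR * (g k * (K * s k))) := by ring
      _ ≤ σR * p k + 1 * (cR * (g k * (K * s k))) := by gcongr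
      _ = _ := by ring
  -- the tracking error
  have hinv : ∀ k : ℕ, 1 / ((k : ℝ) + 1) ≤ g k / gam0 := fun k => by
    have e : g k / gam0 = 1 / ((k : ℝ) + 1) ^ a := by simp only [hg]; field_simp
    rw [e]
    apply one_div_le_one_div_of_le (by positivity)
    calc ((k : ℝ) + 1) ^ a ≤ ((k : ℝ) + 1) ^ (1 : ℝ) :=
          Real.rpow_le_rpow_of_exponent_le (by linarith [Nat.cast_nonneg (α := ℝ) k])
            hupd.a_lt_one.le
      _ = _ := Real.rpow_one _
  have hlamdiff : ∀ k : ℕ, lam k - lam (k + 1) ≤ lam0 * (1 / ((k : ℝ) + 1)) := fun k => by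
    have h1 := regParam_sub_succ_le hl0 (hupd.b_lt_a.trans hupd.a_lt_one).le k (l0 := lam0)
    refine h1.trans ?_
    rw [mul_comm]
    exact mul_le_mul_of_nonneg_right (hlamle k) (by positivity)
  have hlamdiff0 : ∀ k : ℕ, 0 ≤ lam k - lam (k + 1) := fun k =>
    sub_nonneg.2 (regParam_succ_le hl0 hupd.b_pos.le k)
  have hqrec : ∀ k, q (k + 1) ≤ σC * q k + cC * cI * (2 * L) * p k
      + cC * cI * (L * K + lam0 / gam0 * Lf) * g k * s k
      + cC * cI * (lam0 * B) * (1 / ((k : ℝ) + 1)) := fun k => by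
    set D : Fin m → EuclideanSpace ℝ (Fin n) := fun i =>
      (Gg i (x (k + 1) i) + lam (k + 1) • Gf i (x (k + 1) i))
        - (Gg i (x k i) + lam k • Gf i (x k i)) with hD
    have h1 : Y (k + 1) = (C - Matrix.vecMulVec ((m : ℝ)⁻¹ • v) 1 : Matrix (Fin m) (Fin m) ℝ) •
        Y k + (1 - Matrix.vecMulVec ((m : ℝ)⁻¹ • v) 1 : Matrix (Fin m) (Fin m) ℝ) • D := by
      rw [← tracking_step hm hRC.C_col hv, ← hy k]
    have hk1 : 0 ≤ 1 / ((k : ℝ) + 1) := by positivity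
    have h2 : ‖D‖ ≤ 2 * L * p k + (L * K + lam0 / gam0 * Lf) * g k * s k
        + lam0 * B * (1 / ((k : ℝ) + 1)) := by
      have hnn : 0 ≤ 2 * L * p k + (L * K + lam0 / gam0 * Lf) * g k * s k
          + lam0 * B * (1 / ((k : ℝ) + 1)) := by
        have := hp0 k
        have := hs0 k
        have := (hgpos k).le
        positivity
      rw [pi_norm_le_iff_of_nonneg hnn]
      intro i
      -- The motion of the iterate is separated from the change of the parameter: the first
      -- difference is Lipschitz at fixed `lam (k + 1)`, the second is of order `1/k`.
      have e : D i = ((Gg i (x (k + 1) i) + lam (k + 1) • Gf i (x (k + 1) i))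
          - (Gg i (x k i) + lam (k + 1) • Gf i (x k i)))
          - (lam k - lam (k + 1)) • Gf i (x k i) := by
        simp only [hD]; rw [sub_smul]; abel
      have h3 : ‖x (k + 1) i - x k i‖ ≤ 2 * p k + g k * (K * s k) := by
        rw [hx k]
        refine (norm_displacement_le hRC.R_nonneg hRC.R_row u (x k) _ i).trans ?_
        have := hXp k
        exact add_le_add (by linarith) (hstepn k)
      have h4 : ‖Gf i (x k i)‖ ≤ B + Lf * s k := by
        have h5 := norm_sub_le_add_of_mean u (x k) (z k) i
        have h6 : ‖x k i - z k‖ ≤ s k := h5.trans (by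
          have := hXp k
          have := hq0 k
          simp only [hs]
          linarith)
        calc ‖Gf i (x k i)‖ = ‖Gf i (z k) + (Gf i (x k i) - Gf i (z k))‖ := by congr 1; abel
          _ ≤ _ := norm_add_le _ _
          _ ≤ B + Lf * s k := add_le_add (hzB k i)
              ((hfL i _ _).trans (mul_le_mul_of_nonneg_left h6 hLf))
      have h7 : ‖(lam k - lam (k + 1)) • Gf i (x k i)‖
          ≤ lam0 * B * (1 / ((k : ℝ) + 1)) + lam0 / gam0 * Lf * g k * s k := by
        rw [norm_smul, Real.norm_of_nonneg (hlamdiff0 k)]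
        have hsk := hs0 k
        calc _ ≤ lam0 * (1 / ((k : ℝ) + 1)) * (B + Lf * s k) :=
              mul_le_mul (hlamdiff k) h4 (norm_nonneg _) (by positivity)
          _ = lam0 * B * (1 / ((k : ℝ) + 1)) + lam0 * Lf * s k * (1 / ((k : ℝ) + 1)) := by ring
          _ ≤ lam0 * B * (1 / ((k : ℝ) + 1)) + lam0 * Lf * s k * (g k / gam0) :=
              add_le_add le_rfl (mul_le_mul_of_nonneg_left (hinv k) (by positivity))
          _ = _ := by ring
      rw [e]
      refine (norm_sub_le _ _).trans ?_
      have h8 := (hGL (k + 1) i (x (k + 1) i) (x k i)).trans (mul_le_mul_of_nonneg_left h3 hL0)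
      linarith
    have h9 : q (k + 1) ≤ σC * q k + cC * (cI * ‖D‖) := by
      simp only [hq]
      rw [h1]
      exact (hPCadd _ _).trans (add_le_add (hPCc _) ((hPC' _).trans
        (mul_le_mul_of_nonneg_left (hI.norm_smul_le hcI D) hcC)))
    refine h9.trans ?_
    have h10 := mul_le_mul_of_nonneg_left (mul_le_mul_of_nonneg_left h2 hcI) hcC
    linarith
  -- the optimality error
  have hsmall : ∀ η : ℝ, 0 < η → ∀ᶠ k in atTop, g k ≤ η * lam k := fun η hη => by
    filter_upwards [eventually_const_div_rpow_le (sub_pos.2 hupd.b_lt_a) (gam0 / lam0) hη]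
      with k hk
    have hk0 : (0 : ℝ) < (k : ℝ) + 1 := by positivity
    have e : g k = gam0 / lam0 / ((k : ℝ) + 1) ^ (a - b) * lam k := by
      simp only [hg, hlam, regParam]
      rw [Real.rpow_sub hk0]
      field_simp
    rw [e]
    exact mul_le_mul_of_nonneg_right hk (hlam0 k).le
  have hdrec : ∀ᶠ k : ℕ in atTop, d (k + 1) ≤ (1 - θ * μ / 2 * (g k * lam k)) * d k
      + (m * L + 1) * g k * (p k + q k) + cz * (1 / ((k : ℝ) + 1)) := by
    filter_upwards [hsmall (μ / (m * L ^ 2 + 1)) (by positivity),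
      eventually_const_div_rpow_le ha gam0 (show 0 < 2 / (m * (μ * lam0)) by positivity)]
      with k hk1 hk2
    have h1 := norm_mean_step_le hm hu hv.nonneg hv.le (hGL k) hL0 (hupd.step_nonneg k) (hγg k)
      (M := μ * lam k) (mul_pos hμ (hlam0 k)).le
      (fun x y => by
        rw [← Finset.sum_sub_distrib, sum_inner]
        calc (m : ℝ) * (μ * lam k) * ‖x - y‖ ^ 2
            = ∑ _i : Fin m, lam k * (μ * ‖x - y‖ ^ 2) := by simp; ring
          _ ≤ _ := Finset.sum_le_sum fun i _ => by
              have e : (Gg i x + lam k • Gf i x) - (Gg i y + lam k • Gf i y)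
                  = (Gg i x - Gg i y) + lam k • (Gf i x - Gf i y) := by rw [smul_sub]; abel
              rw [e, inner_add_left, real_inner_smul_left]
              have := mul_le_mul_of_nonneg_left (hfμ i x y) (hlam0 k).le
              linarith [hgm i x y])
      (hθk k) (hgpos k).le
      (by
        calc g k * m * L ^ 2 = g k * (m * L ^ 2) := by ring
          _ ≤ g k * (m * L ^ 2 + 1) := by
              have := (hgpos k).le
              gcongr
              linarith
          _ ≤ μ / (m * L ^ 2 + 1) * lam k * (m * L ^ 2 + 1) := by gcongr
          _ = μ * lam k := by field_simp)
      (by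
        rw [le_div_iff₀ (by positivity)] at hk2
        calc g k * m * (μ * lam k) ≤ g k * m * (μ * lam0) := by
              have := (hgpos k).le
              gcongr
              exact hlamle k
          _ = g k * (m * (μ * lam0)) := by ring
          _ ≤ 2 := hk2)
      (hysum k) (hz k)
    rw [← hx k] at h1
    have h2 : d (k + 1) ≤ ‖weightedMean u (x (k + 1)) - z k‖ + ‖z k - z (k + 1)‖ := by
      simp only [hd]
      exact norm_sub_le_norm_sub_add_norm_sub _ _ _
    have h3 : g k * (m * L * ‖X k‖ + ‖Y k‖) ≤ (m * L + 1) * g k * (p k + q k) := by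
      have hpk := hp0 k
      have hqk := hq0 k
      have hgk := (hgpos k).le
      calc _ ≤ g k * (m * L * p k + q k) := by
            gcongr
            · exact hXp k
            · exact hYq k
        _ ≤ g k * (m * L * p k + q k + (m * L * q k + p k)) :=
            mul_le_mul_of_nonneg_left (le_add_of_nonneg_right (by positivity)) hgk
        _ = _ := by ring
    have h4 := hzd k
    calc d (k + 1) ≤ _ := h2
      _ ≤ ((1 - θ * g k * (μ * lam k) / 2) * d k + g k * (m * L * ‖X k‖ + ‖Y k‖))
          + cz * (1 / ((k : ℝ) + 1)) := add_le_add h1 h4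
      _ ≤ ((1 - θ * g k * (μ * lam k) / 2) * d k + (m * L + 1) * g k * (p k + q k))
          + cz * (1 / ((k : ℝ) + 1)) := by gcongr
      _ = _ := by ring
  set c1 := cR * K with hc1
  set c2 := cC * cI * (2 * L) with hc2
  set c3 := cC * cI * (L * K + lam0 / gam0 * Lf) with hc3
  set c4 := cC * cI * (lam0 * B) with hc4
  have hc1' : 0 ≤ c1 := by positivity
  have hc2' : 0 ≤ c2 := by positivity
  have hc3' : 0 ≤ c3 := by positivity
  have hc4' : 0 ≤ c4 := by positivity
  have hmL : 0 ≤ m * L := by positivity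
  set c := m * L + 1 + cz + c1 + c2 + c3 + c4 with hc
  have hle1 : m * L + 1 ≤ c := by linarith
  have hle2 : cz ≤ c := by linarith
  have hle3 : c1 ≤ c := by linarith
  have hle4 : c2 ≤ c := by linarith
  have hle5 : c3 ≤ c := by linarith
  have hle6 : c4 ≤ c := by linarith
  have hc0 : 0 < c := by linarith
  have hinv0 : ∀ k : ℕ, 0 ≤ 1 / ((k : ℝ) + 1) := fun k => by positivity
  have hmono : ∀ c' : ℝ, c' ≤ c → ∀ (k : ℕ) (t : ℝ), 0 ≤ t → c' * g k * t ≤ c * g k * t :=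
    fun c' h k t ht => mul_le_mul_of_nonneg_right
      (mul_le_mul_of_nonneg_right h (hgpos k).le) ht
  obtain ⟨M, hM, h⟩ := coupled_rate_three (d := d) (p := p) (q := q) (c0 := θ * μ / 2) (c := c)
    (σ := max σR σC) hupd.b_pos hupd.b_lt_a hupd.add_lt_one hg0 hl0
    (div_pos (mul_pos hθ hμ) two_pos)
    hc0 (max_lt hσR1 hσC1) (hσR0.trans (le_max_left _ _)) hd0 hp0 hq0
    (hdrec.mono fun k hk => hk.trans (add_le_add
      (add_le_add le_rfl (hmono _ hle1 k _ (add_nonneg (hp0 k) (hq0 k))))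
      (mul_le_mul_of_nonneg_right hle2 (hinv0 k))))
    (Eventually.of_forall fun k => (hprec k).trans (add_le_add
      (mul_le_mul_of_nonneg_right (le_max_left _ _) (hp0 k)) (hmono _ hle3 k _ (hs0 k))))
    (Eventually.of_forall fun k => (hqrec k).trans (add_le_add (add_le_add (add_le_add
      (mul_le_mul_of_nonneg_right (le_max_right _ _) (hq0 k))
      (mul_le_mul_of_nonneg_right hle4 (hp0 k))) (hmono _ hle5 k _ (hs0 k)))
      (mul_le_mul_of_nonneg_right hle6 (hinv0 k))))
  refine ⟨M, hM, ?_⟩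
  filter_upwards [h] with k hk
  exact ⟨hk.1, (hXp k).trans hk.2.1, (hYq k).trans hk.2.2⟩

end Rates

/-! ### Convergence to the solution of the linearly constrained problem -/

lemma isBigO_one_div_rpow {F : ℕ → ℝ} {M r : ℝ} (hr : 0 ≤ r) (hM : 0 ≤ M) (hF : ∀ k, 0 ≤ F k)
    (h : ∀ᶠ k : ℕ in atTop, F k ≤ M * (1 / ((k : ℝ) + 1) ^ r)) :
    F =O[atTop] fun k : ℕ => 1 / (k : ℝ) ^ r := by
  refine Asymptotics.IsBigO.of_bound M ?_
  filter_upwards [h, eventually_ge_atTop 1] with k hk h1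
  have hk0 : (0 : ℝ) < k := by exact_mod_cast h1
  rw [Real.norm_of_nonneg (hF k), Real.norm_of_nonneg (by positivity)]
  refine hk.trans (mul_le_mul_of_nonneg_left ?_ hM)
  exact one_div_le_one_div_of_le (by positivity) (Real.rpow_le_rpow hk0.le (by linarith) hr)

/-- Expanding in the standard basis bounds any seminorm on `ℝ^m` by the sup norm, so rates proved in
the sup norm pass to all the norms of the statement. -/
lemma exists_inducedNorm_le {m n : ℕ} (N : Seminorm ℝ (Fin m → ℝ)) :
    ∃ c : ℝ, 0 ≤ c ∧ ∀ w : Fin m → EuclideanSpace ℝ (Fin n), inducedNorm N w ≤ c * ‖w‖ := by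
  set K : ℝ := ∑ i, N (Pi.single i 1) with hK
  have hK0 : 0 ≤ K := Finset.sum_nonneg fun i _ => apply_nonneg N _
  have hN : ∀ (t : Fin m → ℝ) (D : ℝ), 0 ≤ D → (∀ i, |t i| ≤ D) → N t ≤ D * K :=
    fun t D _ ht => by
      have e : t = ∑ i, t i • (Pi.single i 1 : Fin m → ℝ) := by
        ext l
        simp [Finset.sum_apply, Pi.single_apply]
      calc N t = N (∑ i, t i • (Pi.single i 1 : Fin m → ℝ)) := by rw [← e]
        _ ≤ ∑ i, N (t i • (Pi.single i 1 : Fin m → ℝ)) :=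
            Finset.le_sum_of_subadditive N (map_zero N).le (map_add_le_add N) _ _
        _ ≤ ∑ i, D * N (Pi.single i 1) := Finset.sum_le_sum fun i _ => by
            rw [map_smul_eq_mul, Real.norm_eq_abs]
            exact mul_le_mul_of_nonneg_right (ht i) (apply_nonneg N _)
        _ = D * K := by rw [← Finset.mul_sum]
  refine ⟨√n * K, by positivity, fun w => ?_⟩
  have hcol : ∀ j : Fin n, (N fun i => w i j) ^ 2 ≤ (‖w‖ * K) ^ 2 := fun j =>
    pow_le_pow_left₀ (apply_nonneg N _) (hN _ _ (norm_nonneg w) fun i =>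
      (PiLp.norm_apply_le (w i) j).trans (norm_le_pi_norm w i)) 2
  calc inducedNorm N w ≤ √(n * (‖w‖ * K) ^ 2) := by
        refine Real.sqrt_le_sqrt ((Finset.sum_le_sum fun j _ => hcol j).trans_eq ?_)
        simp
    _ = √n * K * ‖w‖ := by
        rw [Real.sqrt_mul (by positivity), Real.sqrt_sq (by positivity)]
        ring

lemma HasGradientAt.sum_add_mul {m : ℕ} {E : Type*} [NormedAddCommGroup E]
    [InnerProductSpace ℝ E] [CompleteSpace E] {f g : Fin m → E → ℝ} {Gf Gg : Fin m → E} {x : E}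
    (l : ℝ) (hf : ∀ i, HasGradientAt (f i) (Gf i) x) (hg : ∀ i, HasGradientAt (g i) (Gg i) x) :
    HasGradientAt (fun y => ∑ i, g i y + l * ∑ i, f i y) (∑ i, (Gg i + l • Gf i)) x := by
  rw [hasGradientAt_iff_hasFDerivAt]
  have h1 := (HasFDerivAt.fun_sum (u := Finset.univ) fun i _ => (hg i).hasFDerivAt).add
    ((HasFDerivAt.fun_sum (u := Finset.univ) fun i _ => (hf i).hasFDerivAt).const_mul l)
  refine h1.congr_fderiv ?_
  simp [Finset.sum_add_distrib, Finset.smul_sum]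

lemma hasGradientAt_totalFun {m n : ℕ} {f : Fin m → EuclideanSpace ℝ (Fin n) → ℝ}
    {Gf : Fin m → EuclideanSpace ℝ (Fin n)} {x : EuclideanSpace ℝ (Fin n)}
    (hf : ∀ i, HasGradientAt (f i) (Gf i) x) : HasGradientAt (totalFun f) (∑ i, Gf i) x := by
  rw [hasGradientAt_iff_hasFDerivAt, map_sum]
  exact HasFDerivAt.fun_sum fun i _ => (hf i).hasFDerivAt

lemma sum_strongly_monotone {m : ℕ} {E : Type*} [NormedAddCommGroup E]
    [InnerProductSpace ℝ E] {G : Fin m → E → E} {μ : ℝ}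
    (hG : ∀ i x y, μ * ‖x - y‖ ^ 2 ≤ inner ℝ (G i x - G i y) (x - y)) (x y : E) :
    m * μ * ‖x - y‖ ^ 2 ≤ inner ℝ (∑ i, G i x - ∑ i, G i y) (x - y) := by
  rw [← Finset.sum_sub_distrib, sum_inner]
  calc m * μ * ‖x - y‖ ^ 2 = ∑ _i : Fin m, μ * ‖x - y‖ ^ 2 := by simp; ring
    _ ≤ _ := Finset.sum_le_sum fun i _ => hG i x y

theorem corollary1 {m n : ℕ} {p : Fin m → ℕ}
    -- the linearly constrained problem, assumed to be feasible
    (f : Fin m → EuclideanSpace ℝ (Fin n) → ℝ)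
    (A : ∀ i, Matrix (Fin (p i)) (Fin n) ℝ) (b : ∀ i, EuclideanSpace ℝ (Fin (p i)))
    (J : Finset (Fin n))
    (hfeas : (linFeasible A b J).Nonempty)
    -- the objective functions
    (μf Lf : ℝ) (hμf : 0 < μf)
    (hf_convex : ∀ i, IsStronglyConvexC1 μf (f i)) (hf_smooth : ∀ i, IsLSmooth Lf (f i))
    -- the mixing matrices and their eigenvectors
    (R C : Matrix (Fin m) (Fin m) ℝ) (hRC : MixingMatrices R C)
    (u v : Fin m → ℝ) (hu : IsLeftWeight R u) (hv : IsRightWeight C v)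
    -- the step-sizes and the regularization parameters
    (ε : ℝ) (hε : 0 < ε) (hε' : ε < 3 / 5)
    (γ : ℕ → Fin m → ℝ) (gam0 lam0 : ℝ)
    (hupd : UpdateRules u v γ gam0 lam0 (1 / 5) (1 / 5 - ε / 3))
    -- the iterates, from an arbitrary initial point
    (x0 : Fin m → EuclideanSpace ℝ (Fin n))
    (x y : ℕ → Fin m → EuclideanSpace ℝ (Fin n))
    (hx : ∀ k, x k = (pushPull f (penalty A b J) R C γ (regParam lam0 (1 / 5 - ε / 3)) x0 k).1)
    (hy : ∀ k, y k = (pushPull f (penalty A b J) R C γ (regParam lam0 (1 / 5 - ε / 3)) x0 k).2)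
    -- the norms in which the consensus errors are measured
    (NR NC : Seminorm ℝ (Fin m → ℝ)) (_hNR : ∀ w, NR w = 0 → w = 0)
    (_hNC : ∀ w, NC w = 0 → w = 0) :
    -- the linearly constrained problem is equivalent to the bilevel problem
    argminSet (totalFun (penalty A b J)) = linFeasible A b J ∧
    (∀ z, IsOptimalOn (totalFun f) (argminSet (totalFun (penalty A b J))) z ↔
      IsOptimalOn (totalFun f) (linFeasible A b J) z) ∧
    -- the functions `g i` are convex and smooth with a common constant
    (∃ Lg : ℝ, ∀ i, ConvexOn ℝ Set.univ (penalty A b J i) ∧ IsLSmooth Lg (penalty A b J i)) ∧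
    ∃ xs : EuclideanSpace ℝ (Fin n),
      -- `xs` is the unique optimal solution
      (∀ z, IsOptimalOn (totalFun f) (linFeasible A b J) z ↔ z = xs) ∧
      Tendsto (fun k => weightedMean u (x k)) atTop (𝓝 xs) ∧
      (fun k : ℕ => inducedNorm NR fun i => x (k + 1) i - weightedMean u (x (k + 1)))
        =O[atTop] (fun k : ℕ => 1 / (k : ℝ) ^ (3 / 5 + ε / 3)) ∧
      (fun k : ℕ => inducedNorm NC
          fun i => y (k + 1) i - v i • weightedMean (fun _ => 1) (y (k + 1)))
        =O[atTop] (fun k : ℕ => 1 / (k : ℝ) ^ (3 / 5 + ε / 3)) ∧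
      (∃ Q : ℝ, 0 < Q ∧ ∀ᶠ k : ℕ in atTop,
        totalFun f (weightedMean u (x k)) - totalFun f xs ≤ Q * (1 / (k : ℝ) ^ (1 - ε))) ∧
      (fun k : ℕ =>
          ‖Matrix.toEuclideanLin (stackMatrix A) (weightedMean u (x k)) - stackVector b‖ ^ 2)
        =O[atTop] (fun k : ℕ => 1 / (k : ℝ) ^ (1 / 5 - ε / 3)) := by
  have hm := hRC.pos
  have hm' : (0 : ℝ) < m := by exact_mod_cast hm
  have hargmin := argminSet_penalty A b J hm hfeas
  refine ⟨hargmin, fun z => by rw [hargmin], exists_penalty_isLSmooth A b J, ?_⟩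
  have hl0 := hupd.lam0_pos
  set bb : ℝ := 1 / 5 - ε / 3 with hbb
  have hb0 : 0 < bb := hupd.b_pos
  set lam : ℕ → ℝ := regParam lam0 bb with hlam
  have hlam0 : ∀ k, 0 < lam k := fun k => regParam_pos hl0 k
  have hlamle : ∀ k, lam k ≤ lam0 := fun k => regParam_le hl0 hb0.le k
  -- gradients
  set Gf : Fin m → EuclideanSpace ℝ (Fin n) → EuclideanSpace ℝ (Fin n) :=
    fun i => gradient (f i) with hGf
  have hfG : ∀ i x, HasGradientAt (f i) (Gf i x) x := fun i x =>
    ((hf_smooth i).2.1.differentiable one_ne_zero x).hasGradientAt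
  have hLf : 0 < Lf := (hf_smooth ⟨0, hm⟩).1
  have hfL : ∀ i x y, ‖Gf i x - Gf i y‖ ≤ Lf * ‖x - y‖ := fun i => (hf_smooth i).2.2
  have hfμ : ∀ i x y, μf * ‖x - y‖ ^ 2 ≤ inner ℝ (Gf i x - Gf i y) (x - y) :=
    fun i => (hf_convex i).2
  set Gg := penaltyGrad A b J with hGg
  have hgG : ∀ i x, HasGradientAt (penalty A b J i) (Gg i x) x := hasGradientAt_penalty A b J
  have hgm : ∀ i x y, 0 ≤ inner ℝ (Gg i x - Gg i y) (x - y) := penaltyGrad_monotone A b J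
  obtain ⟨Lg, hLg, hgL⟩ : ∃ Lg, 0 ≤ Lg ∧ ∀ i x y, ‖Gg i x - Gg i y‖ ≤ Lg * ‖x - y‖ := by
    obtain ⟨Lg, h⟩ := exists_penalty_isLSmooth A b J
    refine ⟨Lg, (h ⟨0, hm⟩).2.1.le, fun i x y => ?_⟩
    have := (h i).2.2.2 x y
    rwa [(hgG i x).gradient, (hgG i y).gradient] at this
  -- the total functions
  set F := totalFun f with hF
  set g := totalFun (penalty A b J) with hg
  have hFG : ∀ x, HasGradientAt F (∑ i, Gf i x) x := fun x =>
    hasGradientAt_totalFun fun i => hfG i x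
  have hFμ := sum_strongly_monotone hfμ
  have hmμ : 0 < m * μf := mul_pos hm' hμf
  obtain ⟨xs, hxs⟩ := HasGradientAt.exists_min_on hmμ hFG hFμ (isClosed_linFeasible A b J hm) hfeas
  have hgxs : g xs = 0 := (totalFun_penalty_eq_zero_iff A b J hm xs).2 hxs.1
  have hg0 : ∀ x, 0 ≤ g x := totalFun_penalty_nonneg A b J
  have hopt : ∀ z, IsOptimalOn F (linFeasible A b J) z ↔ z = xs := fun z =>
    ⟨fun hz => HasGradientAt.isOptimalOn_unique hmμ hFG hFμ (convex_linFeasible A b J) hz hxs,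
      fun hz => hz ▸ hxs⟩
  obtain ⟨cF, hcF⟩ := HasGradientAt.exists_lower_bound hmμ hFG hFμ
  -- the regularized solutions
  have hΦG : ∀ k x, HasGradientAt (fun y => g y + lam k * F y)
      (∑ i, (Gg i x + lam k • Gf i x)) x := fun k x =>
    HasGradientAt.sum_add_mul (lam k) (fun i => hfG i x) (fun i => hgG i x)
  have hΦμ : ∀ k x y, m * (lam k * μf) * ‖x - y‖ ^ 2 ≤
      inner ℝ (∑ i, (Gg i x + lam k • Gf i x) - ∑ i, (Gg i y + lam k • Gf i y)) (x - y) :=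
    fun k => sum_strongly_monotone (G := fun i x => Gg i x + lam k • Gf i x) fun i x y => by
      have e : (Gg i x + lam k • Gf i x) - (Gg i y + lam k • Gf i y)
          = (Gg i x - Gg i y) + lam k • (Gf i x - Gf i y) := by rw [smul_sub]; abel
      rw [e, inner_add_left, real_inner_smul_left]
      have := mul_le_mul_of_nonneg_left (hfμ i x y) (hlam0 k).le
      linarith [hgm i x y]
  have hΦL : ∀ k x y, ‖∑ i, (Gg i x + lam k • Gf i x) - ∑ i, (Gg i y + lam k • Gf i y)‖
      ≤ m * (Lg + lam0 * Lf) * ‖x - y‖ := fun k x y => by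
    refine norm_sum_sub_le (G := fun i x => Gg i x + lam k • Gf i x) (fun i x y => ?_)
      (by positivity) (x := fun _ => x) (y := fun _ => y) fun _ => le_rfl
    have e : (Gg i x + lam k • Gf i x) - (Gg i y + lam k • Gf i y)
        = (Gg i x - Gg i y) + lam k • (Gf i x - Gf i y) := by rw [smul_sub]; abel
    rw [e, add_mul, mul_assoc]
    refine (norm_add_le _ _).trans (add_le_add (hgL i x y) ?_)
    rw [norm_smul, Real.norm_of_nonneg (hlam0 k).le]
    exact mul_le_mul (hlamle k) (hfL i x y) (norm_nonneg _) hl0.le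
  choose z hz using fun k => HasGradientAt.exists_min_on
    (mul_pos hm' (mul_pos (hlam0 k) hμf)) (hΦG k) (hΦμ k) isClosed_univ Set.univ_nonempty
  have hzmin : ∀ k w, g (z k) + lam k * F (z k) ≤ g w + lam k * F w := fun k w =>
    (hz k).2 w (Set.mem_univ w)
  have hz0 : ∀ k, ∑ i, (Gg i (z k) + lam k • Gf i (z k)) = 0 := fun k =>
    HasGradientAt.eq_zero_of_forall_le (G := fun x => ∑ i, (Gg i x + lam k • Gf i x))
      (hΦG k (z k)) (hzmin k)
  set r : ℝ := 2 * ‖∑ i, Gf i xs‖ / (m * μf) with hr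
  -- Comparing `z k` with `xs`, where `g` vanishes, gives `F (z k) ≤ F xs`: the whole path lies in
  -- one bounded sublevel set.
  have hzr : ∀ k, ‖z k - xs‖ ≤ r := fun k => by
    refine HasGradientAt.norm_sub_le_of_le hmμ hFG hFμ ?_
    have h1 := hzmin k xs
    have h2 := hg0 (z k)
    rw [hgxs] at h1
    exact le_of_mul_le_mul_left (by linarith) (hlam0 k)
  set B : ℝ := ∑ i, ‖Gf i xs‖ + Lf * r with hB
  have hr0 : 0 ≤ r := by positivity
  have hB0 : 0 ≤ B := by positivity
  have hzB : ∀ k i, ‖Gf i (z k)‖ ≤ B := fun k i => by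
    calc ‖Gf i (z k)‖ = ‖Gf i xs + (Gf i (z k) - Gf i xs)‖ := by congr 1; abel
      _ ≤ _ := norm_add_le _ _
      _ ≤ B := add_le_add
        (Finset.single_le_sum (f := fun i => ‖Gf i xs‖) (fun _ _ => norm_nonneg _)
          (Finset.mem_univ i))
        ((hfL i _ _).trans (mul_le_mul_of_nonneg_left (hzr k) hLf.le))
  have hzd : ∀ k : ℕ, ‖z k - z (k + 1)‖ ≤ m * B / (m * μf) * (1 / ((k : ℝ) + 1)) := fun k => by
    have h1 := norm_sub_le_of_regularized (Gf := fun x => ∑ i, Gf i x)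
      (Gg := fun x => ∑ i, Gg i x) (l' := lam (k + 1)) (hlam0 k) hmμ (hFμ (z k) (z (k + 1)))
      (by
        have := sum_strongly_monotone (μ := 0) (fun i x y => by rw [zero_mul]; exact hgm i x y)
          (z k) (z (k + 1))
        simpa using this)
      (by
        have := hz0 k
        rwa [Finset.sum_add_distrib, ← Finset.smul_sum] at this)
      (by
        have := hz0 (k + 1)
        rwa [Finset.sum_add_distrib, ← Finset.smul_sum] at this)
    refine h1.trans ?_
    rw [mul_comm]
    have h2 : |lam k - lam (k + 1)| / lam k ≤ 1 / ((k : ℝ) + 1) := by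
      rw [abs_of_nonneg (sub_nonneg.2 (regParam_succ_le hl0 hb0.le k)), div_le_iff₀ (hlam0 k)]
      exact regParam_sub_succ_le hl0 (hupd.b_lt_a.trans hupd.a_lt_one).le k
    have h3 : ‖∑ i, Gf i (z (k + 1))‖ ≤ m * B := by
      calc _ ≤ ∑ i, ‖Gf i (z (k + 1))‖ := norm_sum_le _ _
        _ ≤ ∑ _i : Fin m, B := Finset.sum_le_sum fun i _ => hzB (k + 1) i
        _ = m * B := by simp
    have := hlam0 k
    gcongr
  have hzlim : Tendsto z atTop (𝓝 xs) := by
    refine tendsto_of_regularized (HasGradientAt.continuous_of_forall hFG)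
      (continuous_totalFun_penalty A b J) hg0 hcF hgxs (fun w hw hwF => ?_) hlam0
      (tendsto_const_div_rpow_zero hb0 lam0) (fun k => hzmin k xs) hzr
    refine (hopt w).1 ⟨(totalFun_penalty_eq_zero_iff A b J hm w).1 hw, fun t ht => ?_⟩
    exact hwF.trans (hxs.2 t ht)
  -- the rates
  obtain ⟨M, hM, hrate⟩ := pushPull_rates hRC hu hv hupd (Gf := Gf) (Gg := Gg) (B := B) hμf
    hLf.le hLg hB0 (by positivity) hfL hgL hfμ hgm
    (x := x) (y := y)
    (fun k => by rw [hx (k + 1), hx k, hy k]; rfl)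
    (fun i => by
      rw [hy 0, hx 0, ← (hgG i _).gradient]; rfl)
    (fun k => by
      have hgrad : ∀ i, gradient (penalty A b J i) = Gg i := fun i => gradient_eq (hgG i)
      rw [hx (k + 1), hx k, hy (k + 1), hy k]
      funext i
      simp only [pushPull, hgrad, Pi.add_apply, Matrix.Module.smul_apply]
      abel)
    hz0 hzB hzd
  have hexp : (1 : ℝ) - 1 / 5 - bb = 3 / 5 + ε / 3 := by rw [hbb]; ring
  rw [hexp] at hrate
  set w : ℕ → ℝ := fun k => 1 / ((k : ℝ) + 1) ^ (3 / 5 + ε / 3) with hw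
  have hr' : 0 < 3 / 5 + ε / 3 := by positivity
  have hw0 : ∀ k, 0 < w k := fun k => by positivity
  have hshift : ∀ᶠ k : ℕ in atTop,
      ‖fun i => x (k + 1) i - weightedMean u (x (k + 1))‖ ≤ M * w k ∧
      ‖fun i => y (k + 1) i - v i • weightedMean (fun _ => 1) (y (k + 1))‖ ≤ M * w k := by
    filter_upwards [(tendsto_add_atTop_nat 1).eventually hrate] with k hk
    have h1 := mul_le_mul_of_nonneg_left (one_div_rpow_succ_le hr'.le k) hM
    exact ⟨hk.2.1.trans h1, hk.2.2.trans h1⟩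
  obtain ⟨cR, hcR, hNR⟩ := exists_inducedNorm_le (n := n) NR
  obtain ⟨cC, hcC, hNC⟩ := exists_inducedNorm_le (n := n) NC
  -- the function values
  set LF : ℝ := m * (Lg + lam0 * Lf) with hLF
  have hLF0 : 0 ≤ LF := by positivity
  -- Quadratic growth around the minimizer `z k` costs the square of the distance rate, and the
  -- minimum is at most `lam k * F xs`.
  have hval : ∀ᶠ k : ℕ in atTop, g (weightedMean u (x k)) + lam k * F (weightedMean u (x k))
      ≤ lam k * F xs + LF * M ^ 2 * w k ^ 2 := by
    filter_upwards [hrate] with k hk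
    have h1 := HasGradientAt.sub_le_of_eq_zero (G := fun x => ∑ i, (Gg i x + lam k • Gf i x))
      (hΦG k) hLF0 (fun x => hΦL k x (z k)) (hz0 k) (weightedMean u (x k))
    have h2 := hzmin k xs
    rw [hgxs] at h2
    have h3 : LF * ‖weightedMean u (x k) - z k‖ ^ 2 ≤ LF * (M * w k) ^ 2 := by
      gcongr
      exact hk.1
    have h4 : LF * (M * w k) ^ 2 = LF * M ^ 2 * w k ^ 2 := by ring
    linarith
  refine ⟨xs, hopt, ?_, ?_, ?_, ?_, ?_⟩
  · have h1 : Tendsto (fun k => weightedMean u (x k) - z k) atTop (𝓝 0) := by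
      refine squeeze_zero_norm' (a := fun k => M * w k) (hrate.mono fun k hk => hk.1) ?_
      have h2 := (tendsto_const_div_rpow_zero hr' 1).const_mul M
      rwa [mul_zero] at h2
    simpa using h1.add hzlim
  · refine isBigO_one_div_rpow (M := cR * M) hr'.le (by positivity)
      (fun k => Real.sqrt_nonneg _) ?_
    filter_upwards [hshift] with k hk
    rw [mul_assoc]
    exact (hNR _).trans (mul_le_mul_of_nonneg_left hk.1 hcR)
  · refine isBigO_one_div_rpow (M := cC * M) hr'.le (by positivity)
      (fun k => Real.sqrt_nonneg _) ?_
    filter_upwards [hshift] with k hk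
    rw [mul_assoc]
    exact (hNC _).trans (mul_le_mul_of_nonneg_left hk.2 hcC)
  · refine ⟨LF * M ^ 2 / lam0 + 1, by positivity, ?_⟩
    filter_upwards [hval, eventually_ge_atTop 1] with k hk h1
    have hk1 : (1 : ℝ) ≤ k := by exact_mod_cast h1
    have hk0 : (0 : ℝ) < (k : ℝ) + 1 := by positivity
    -- Exponents: `2 (3/5 + ε/3) = (1/5 - ε/3) + (1 + ε)`. Dividing by `lam k` therefore leaves the
    -- order `1 + ε`, which is better than the claimed `1 - ε`.
    have h2 : w k ^ 2 = lam k * (1 / lam0 * (1 / ((k : ℝ) + 1) ^ (1 + ε))) := by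
      have e1 : ((k : ℝ) + 1) ^ (3 / 5 + ε / 3) * ((k : ℝ) + 1) ^ (3 / 5 + ε / 3)
          = ((k : ℝ) + 1) ^ bb * ((k : ℝ) + 1) ^ (1 + ε) := by
        rw [← Real.rpow_add hk0, ← Real.rpow_add hk0]
        congr 1
        rw [hbb]; ring
      simp only [hw, hlam, regParam]
      rw [sq, div_mul_div_comm, e1]
      field_simp
    have h3 : 1 / ((k : ℝ) + 1) ^ (1 + ε) ≤ 1 / (k : ℝ) ^ (1 - ε) := by
      apply one_div_le_one_div_of_le (by positivity)
      calc (k : ℝ) ^ (1 - ε) ≤ (k : ℝ) ^ (1 + ε) :=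
            Real.rpow_le_rpow_of_exponent_le hk1 (by linarith)
        _ ≤ _ := Real.rpow_le_rpow (by positivity) (by linarith) (by positivity)
    have h4 : F (weightedMean u (x k)) - F xs
        ≤ LF * M ^ 2 / lam0 * (1 / ((k : ℝ) + 1) ^ (1 + ε)) := by
      refine le_of_mul_le_mul_left ?_ (hlam0 k)
      have e2 : lam k * (LF * M ^ 2 / lam0 * (1 / ((k : ℝ) + 1) ^ (1 + ε)))
          = LF * M ^ 2 * w k ^ 2 := by
        rw [h2]; ring
      rw [e2]
      have := hg0 (weightedMean u (x k))
      linarith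
    have hpos : 0 ≤ 1 / (k : ℝ) ^ (1 - ε) := by positivity
    calc _ ≤ LF * M ^ 2 / lam0 * (1 / ((k : ℝ) + 1) ^ (1 + ε)) := h4
      _ ≤ LF * M ^ 2 / lam0 * (1 / (k : ℝ) ^ (1 - ε)) := by gcongr
      _ ≤ _ := mul_le_mul_of_nonneg_right (by linarith) hpos
  -- Bounding `F` below by `cF` leaves `g ≤ lam k * (F xs - cF)` plus a term of order `w k ^ 2`, so
  -- the regularization parameter sets the infeasibility rate.
  · have hFc : 0 ≤ F xs - cF := sub_nonneg.2 (hcF xs)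
    refine isBigO_one_div_rpow (M := 2 * (lam0 * (F xs - cF) + LF * M ^ 2)) hb0.le
      (by positivity) (fun k => sq_nonneg _) ?_
    filter_upwards [hval] with k hk
    have hk0 : (1 : ℝ) ≤ (k : ℝ) + 1 := by linarith [Nat.cast_nonneg (α := ℝ) k]
    have h1 : w k ^ 2 ≤ 1 / ((k : ℝ) + 1) ^ bb := by
      have e1 : ((k : ℝ) + 1) ^ bb ≤ ((k : ℝ) + 1) ^ (3 / 5 + ε / 3) :=
        Real.rpow_le_rpow_of_exponent_le hk0 (by rw [hbb]; linarith)
      have h2 : w k ≤ 1 / ((k : ℝ) + 1) ^ bb := one_div_le_one_div_of_le (by positivity) e1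
      have h3 : w k ≤ 1 := by
        rw [hw]
        exact div_le_one_of_le₀ (Real.one_le_rpow hk0 hr'.le) (by positivity)
      rw [sq]
      calc w k * w k ≤ w k * 1 := mul_le_mul_of_nonneg_left h3 (hw0 k).le
        _ = w k := mul_one _
        _ ≤ _ := h2
    have h4 : lam k = lam0 * (1 / ((k : ℝ) + 1) ^ bb) := by
      simp only [hlam, regParam]; ring
    refine (norm_stack_sq_le A b J _).trans ?_
    have h5 := mul_le_mul_of_nonneg_left (hcF (weightedMean u (x k))) (hlam0 k).le
    have h6 : LF * M ^ 2 * w k ^ 2 ≤ LF * M ^ 2 * (1 / ((k : ℝ) + 1) ^ bb) := by gcongr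
    have h7 : 2 * (lam0 * (F xs - cF) + LF * M ^ 2) * (1 / ((k : ℝ) + 1) ^ bb)
        = 2 * (lam k * (F xs - cF) + LF * M ^ 2 * (1 / ((k : ℝ) + 1) ^ bb)) := by
      rw [h4]; ring
    rw [h7]
    linarith
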